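/- Conventions. Manifolds are finite-dimensional, real and $C^\infty$; a manifold may have components of different dimensions unless it is said to be of constant dimension. A Lie groupoid $\Gamma\rightrightarrows M$ is a groupoid whose set of objects $M$ is a Hausdorff, second countable manifold of constant dimension, whose set of arrows $\Gamma$ is a second countable manifold, whose source $s$ and target $t$ are smooth submersions, and whose composition $m:\Gamma\times_{s,t}\Gamma\to\Gamma$, $(g',g)\mapsto g'g$ (where $s(g')=t(g)$), unit map $x\mapsto 1_x$ and inversion are smooth. It is proper if $\Gamma$ is Hausdorff and the preimage of every compact subset of $M\times M$ under $(s,t):\Gamma\to M\times M$ is compact. It is a Lie group bundle if $s=t$. The tangent groupoid $T\Gamma\rightrightarrows TM$ is the groupoid whose structure maps are the tangent maps of the structure maps of $\Gamma$ (with $T(\Gamma\times_{s,t}\Gamma)=T\Gamma\times_{Ts,Tt}T\Gamma$). A connection on $\Gamma$ is a $C^\infty$ section $\eta$ of the vector bundle $L(s^*TM,T\Gamma)$ over $\Gamma$, given by linear maps $\eta_g:T_{s(g)}M\to T_g\Gamma$, such that $T_gs\circ\eta_g=\mathrm{id}$ for every $g\in\Gamma$. It is multiplicative if its horizontal bundle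 $H=\bigcup_{g\in\Gamma}\eta_g(T_{s(g)}M)\subset T\Gamma$ is a subgroupoid of $T\Gamma\rightrightarrows TM$ over the whole of $TM$, that is, contains all units of $T\Gamma$ and is closed under the composition and the inversion of $T\Gamma$. Corollary 3.8. Every proper Lie group bundle $\Gamma\rightrightarrows M$ (that is, every proper Lie groupoid with $s=t$) admits a multiplicative connection. -/

import Mathlib

open scoped Manifold ContDiff Topology

universe u v w

noncomputable section

/-- The standard model space of dimension `n`. -/
abbrev Model (n : ℕ) : Type := EuclideanSpace ℝ (Fin n)

/-- The disjoint union of a family `G` of manifolds, `G n` being of dimension `n`. Up to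
diffeomorphism these are exactly the finite-dimensional manifolds that are allowed to have
components of different dimensions; `G n` is the union of the `n`-dimensional components
(and may be empty). -/
abbrev Arrows (G : ℕ → Type v) : Type v := Σ n, G n

/-- The tangent bundle of the disjoint union `Arrows G`. -/
abbrev TArrows (G : ℕ → Type v) [∀ n, TopologicalSpace (G n)]
    [∀ n, ChartedSpace (Model n) (G n)] : Type v :=
  Σ n, TangentBundle (𝓡 n) (G n)

section Smooth

variable {E : Type*} [NormedAddCommGroup E] [NormedSpace ℝ E] {H : Type*} [TopologicalSpace H]
  (I : ModelWithCorners ℝ E H) {N : Type w} [TopologicalSpace N] [ChartedSpace H N]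
  {G : ℕ → Type v} [∀ n, TopologicalSpace (G n)] [∀ n, ChartedSpace (Model n) (G n)]

/-- `F : N → G n` is a smooth local extension, near `x`, of the map `f : S → Arrows G` defined on
a subset `S` of the manifold `N`. -/
def IsLocalExtension (S : Set N) (f : ∀ x : N, x ∈ S → Arrows G) (x : N) (n : ℕ)
    (F : N → G n) : Prop :=
  ContMDiffAt I (𝓡 n) ∞ F x ∧ ∀ᶠ y in 𝓝 x, ∀ hy : y ∈ S, f y hy = ⟨n, F y⟩

/-- A map `f : S → Arrows G` on a subset `S` of a manifold `N` is smooth if it has smooth local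
extensions to the ambient manifold at all points of `S`. When `S` is a submanifold this is
smoothness of `f` as a map between manifolds; in particular this is so for `S = univ`. -/
def SmoothFrom (S : Set N) (f : ∀ x : N, x ∈ S → Arrows G) : Prop :=
  ∀ x ∈ S, ∃ (n : ℕ) (F : N → G n), IsLocalExtension I S f x n F

/-- The tangent map `TS → T(Arrows G)` of a smooth map `f : S → Arrows G`, computed at a tangent
vector of `N` with foot point in `S` through a smooth local extension of `f`. On vectors tangent
to the submanifold `S`, the result does not depend on which extension is used (all of them have
the same differential along `S`). -/
def SmoothFrom.tangent {I : ModelWithCorners ℝ E H} {S : Set N}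
    {f : ∀ x : N, x ∈ S → Arrows G} (hf : SmoothFrom I S f)
    (ξ : TangentBundle I N) (hξ : ξ.proj ∈ S) : TArrows G :=
  ⟨(hf ξ.proj hξ).choose, tangentMap I (𝓡 _) (hf ξ.proj hξ).choose_spec.choose ξ⟩

end Smooth

/-- A differentiable groupoid `Arrows G ⇉ M`. Its base is a manifold of constant dimension `d`; the
arrow manifold `Arrows G` may have components of different dimensions. The composition
`mul g' g` (`g` first, then `g'`) is defined when `src g' = tgt g`. -/
structure DiffGroupoid (d : ℕ) (M : Type u) [TopologicalSpace M] [ChartedSpace (Model d) M]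
    (G : ℕ → Type v) [∀ n, TopologicalSpace (G n)] [∀ n, ChartedSpace (Model n) (G n)] where
  src : Arrows G → M
  tgt : Arrows G → M
  one : M → Arrows G
  inv : Arrows G → Arrows G
  mul : ∀ g' g : Arrows G, src g' = tgt g → Arrows G
  src_one : ∀ x, src (one x) = x
  tgt_one : ∀ x, tgt (one x) = x
  src_inv : ∀ g, src (inv g) = tgt g
  tgt_inv : ∀ g, tgt (inv g) = src g
  src_mul : ∀ g' g h, src (mul g' g h) = src g
  tgt_mul : ∀ g' g h, tgt (mul g' g h) = tgt g'
  mul_assoc : ∀ g'' g' g (h₁ : src g'' = tgt g') (h₂ : src g' = tgt g),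
    mul (mul g'' g' h₁) g ((src_mul g'' g' h₁).trans h₂) =
      mul g'' (mul g' g h₂) (h₁.trans (tgt_mul g' g h₂).symm)
  one_mul : ∀ g, mul (one (tgt g)) g (src_one _) = g
  mul_one : ∀ g, mul g (one (src g)) (tgt_one _).symm = g
  inv_mul : ∀ g, mul (inv g) g (src_inv g) = one (src g)
  mul_inv : ∀ g, mul g (inv g) (tgt_inv g).symm = one (tgt g)
  /-- The source map is a smooth submersion. -/
  submersion_src : ∀ n, Manifold.IsSubmersion (𝓡 n) (𝓡 d) ∞ (fun g : G n => src ⟨n, g⟩)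
  /-- The target map is a smooth submersion. -/
  submersion_tgt : ∀ n, Manifold.IsSubmersion (𝓡 n) (𝓡 d) ∞ (fun g : G n => tgt ⟨n, g⟩)
  /-- The unit map is smooth. -/
  smooth_one : SmoothFrom (𝓡 d) Set.univ (fun x _ => one x)
  /-- The inversion is smooth. -/
  smooth_inv : ∀ n, SmoothFrom (𝓡 n) Set.univ (fun (g : G n) _ => inv ⟨n, g⟩)
  /-- The composition is smooth on the submanifold of composable pairs. -/
  smooth_mul : ∀ m n, SmoothFrom ((𝓡 m).prod (𝓡 n))
    {p : G m × G n | src ⟨m, p.1⟩ = tgt ⟨n, p.2⟩} (fun p hp => mul ⟨m, p.1⟩ ⟨n, p.2⟩ hp)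

namespace DiffGroupoid

variable {d : ℕ} {M : Type u} [TopologicalSpace M] [ChartedSpace (Model d) M]
  {G : ℕ → Type v} [∀ n, TopologicalSpace (G n)] [∀ n, ChartedSpace (Model n) (G n)]
  (Γ : DiffGroupoid d M G)

/-- A Lie groupoid: the base is Hausdorff and second countable (and of constant dimension) and the
manifold of arrows is second countable. -/
def IsLie (_Γ : DiffGroupoid d M G) : Prop :=
  T2Space M ∧ SecondCountableTopology M ∧ SecondCountableTopology (Arrows G)

/-- A proper groupoid: base and arrow manifold are Hausdorff and the preimages of compact sets
under the anchor `(s, t) : Γ → M × M` are compact. -/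
def IsProper : Prop :=
  T2Space M ∧ T2Space (Arrows G) ∧
    ∀ K : Set (M × M), IsCompact K → IsCompact ((fun g => (Γ.src g, Γ.tgt g)) ⁻¹' K)

/-- A bundle of groups: source and target coincide. -/
def IsGroupBundle : Prop := ∀ g, Γ.src g = Γ.tgt g

/-! ### The tangent groupoid -/

/-- The source map `Ts` of the tangent groupoid. -/
def tsrc (ξ : TArrows G) : TangentBundle (𝓡 d) M :=
  tangentMap (𝓡 ξ.1) (𝓡 d) (fun g => Γ.src ⟨ξ.1, g⟩) ξ.2

/-- The target map `Tt` of the tangent groupoid. -/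
def ttgt (ξ : TArrows G) : TangentBundle (𝓡 d) M :=
  tangentMap (𝓡 ξ.1) (𝓡 d) (fun g => Γ.tgt ⟨ξ.1, g⟩) ξ.2

/-- The unit map of the tangent groupoid, the tangent map of the unit map. -/
def tone (v : TangentBundle (𝓡 d) M) : TArrows G :=
  Γ.smooth_one.tangent v (Set.mem_univ _)

/-- The inversion of the tangent groupoid, the tangent map of the inversion. -/
def tinv (ξ : TArrows G) : TArrows G :=
  (Γ.smooth_inv ξ.1).tangent ξ.2 (Set.mem_univ _)

/-- The composition of the tangent groupoid: the tangent map of the composition, applied to a pair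
of tangent vectors `(ξ', ξ)` with `Ts ξ' = Tt ξ`, that is, to a vector which is tangent to the
submanifold of composable pairs of arrows. -/
def tmul (ξ' ξ : TArrows G) (h : Γ.tsrc ξ' = Γ.ttgt ξ) : TArrows G :=
  (Γ.smooth_mul ξ'.1 ξ.1).tangent
    ((equivTangentBundleProd (𝓡 ξ'.1) (G ξ'.1) (𝓡 ξ.1) (G ξ.1)).symm (ξ'.2, ξ.2))
    (congrArg Bundle.TotalSpace.proj h)

/-! ### Connections -/

/-- A smooth connection on a groupoid: a smooth section `η` of the vector bundle `L(s^*TM, TΓ)`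
over the manifold of arrows such that `Ts ∘ η_g` is the identity of `T_{s(g)} M` for every
arrow `g`. Smoothness of the section at `g₀` is expressed, as usual, in the local trivializations
of `TM` and `TΓ` which are given by the preferred charts at `s(g₀)` and `g₀`. -/
structure Connection [IsManifold (𝓡 d) ∞ M] [∀ n, IsManifold (𝓡 n) ∞ (G n)]
    (Γ : DiffGroupoid d M G) where
  /-- The horizontal lift. -/
  lift : ∀ (n : ℕ) (g : G n),
    TangentSpace (𝓡 d) (Γ.src ⟨n, g⟩) →L[ℝ] TangentSpace (𝓡 n) g
  smooth_lift : ∀ (n : ℕ) (g₀ : G n),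
    ContMDiffAt (𝓡 n) 𝓘(ℝ, Model d →L[ℝ] Model n) ∞
      (inTangentCoordinates (𝓡 d) (𝓡 n) (fun g : G n => Γ.src ⟨n, g⟩) id (lift n) g₀) g₀
  src_lift : ∀ (n : ℕ) (g : G n) (v : TangentSpace (𝓡 d) (Γ.src ⟨n, g⟩)),
    mfderiv (𝓡 n) (𝓡 d) (fun g : G n => Γ.src ⟨n, g⟩) g (lift n g v) = v

variable {Γ} [IsManifold (𝓡 d) ∞ M] [∀ n, IsManifold (𝓡 n) ∞ (G n)]

/-- The horizontal subbundle of the tangent bundle, the image of the horizontal lift. -/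
def Connection.horizontal (η : Γ.Connection) : Set (TArrows G) :=
  {ξ | ∃ (n : ℕ) (g : G n) (v : TangentSpace (𝓡 d) (Γ.src ⟨n, g⟩)), ξ = ⟨n, ⟨g, η.lift n g v⟩⟩}

/-- A connection is multiplicative if its horizontal subbundle is a subgroupoid, over the whole
of `TM`, of the tangent groupoid: it contains all units and it is closed under inversion and
composition. -/
structure Connection.IsMultiplicative (η : Γ.Connection) : Prop where
  tone_mem : ∀ v : TangentBundle (𝓡 d) M, Γ.tone v ∈ η.horizontal
  tinv_mem : ∀ ξ ∈ η.horizontal, Γ.tinv ξ ∈ η.horizontal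
  tmul_mem : ∀ ξ' ∈ η.horizontal, ∀ ξ ∈ η.horizontal, ∀ h : Γ.tsrc ξ' = Γ.ttgt ξ,
    Γ.tmul ξ' ξ h ∈ η.horizontal

end DiffGroupoid

end

/-! A multiplicative connection assigns smoothly to every arrow `g` a 1-jet `η(g)` of local sections
through `g`, in such a way that `η(ab) = η(a)·η(b)` for the product of jets. Take any connection
`λ`, glued from slice charts by a partition of unity. For `a` in the fibre of `g` put `δ(g,a) =
λ(ga)·λ(a)⁻¹`, again a jet through `g`. These quotients telescope: `δ(a,bc)·δ(b,c) = δ(ab,c)`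
(`jet_mul_quotientSection`). The fibres are compact groups, so `η(g) = ∫ δ(g,c) dc` makes sense for
a normalized left-invariant measure. For a fixed pair `(a,b)` the product of jets is given by one
linear map, a derivative of the multiplication (`exists_mulDeriv`), hence commutes with averaging,
and `η(ab) = ∫ δ(a,bc)·δ(b,c) dc = η(a)·η(b)`, left invariance removing `b` from the first factor
(`averagedLift_mul`).

The invariant measures are explicit. In a slice chart the density is carried from the unit by the
Jacobian of left translation (`density_mul`), so invariance is the change of variables formula
(`fiberIntegral_mul_left`). Properness makes the sums locally finite and the integrands compactly
supported, which gives smooth dependence on `g` (`FiberSmooth.contMDiffAt_fiberIntegral`).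

Units and inverses follow from products by cancellation (`jet_one`, `jet_inv`). Components of
different dimensions do not interact: translation by a local section is a local diffeomorphism, so
all arrows over one point have the same dimension (`fst_eq_fst_one`), and each `G n` is a group
bundle over an open part of `M`. -/

noncomputable section

/-! ### Slice charts of a submersion -/

section SliceChart

variable {d n k : ℕ} {M : Type u} [TopologicalSpace M] [ChartedSpace (Model d) M]
  {N : Type v} [TopologicalSpace N] [ChartedSpace (Model n) N]

/-- A slice chart of `proj : N → M`: a smooth chart `N ⊇ source ≃ target ⊆ M × ℝᵏ` in which `proj`
becomes the first projection. -/
structure SliceChart (k : ℕ) (proj : N → M) where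
  chart : OpenPartialHomeomorph N (M × Model k)
  fst_eq : ∀ g ∈ chart.source, (chart g).1 = proj g
  smooth : ContMDiffOn (𝓡 n) ((𝓡 d).prod (𝓡 k)) ∞ chart chart.source
  smooth_symm : ContMDiffOn ((𝓡 d).prod (𝓡 k)) (𝓡 n) ∞ chart.symm chart.target

/-- In adapted charts a submersion is a linear projection. Undoing the chart of the base on the
first factor turns this into an exact projection to `M`. The subtraction `n - d` does not truncate,
since `n` is `d` plus the dimension of the complement. -/
theorem exists_sliceChart [IsManifold (𝓡 d) ∞ M] [IsManifold (𝓡 n) ∞ N] {proj : N → M} {g : N}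
    (h : Manifold.IsSubmersionAt (𝓡 n) (𝓡 d) ∞ proj g) :
    ∃ Φ : SliceChart (d := d) (n := n) (n - d) proj, g ∈ Φ.chart.source := by
  have hfin : FiniteDimensional ℝ h.complement := by
    have : FiniteDimensional ℝ (Model d × h.complement) := h.equiv.toLinearEquiv.finiteDimensional
    exact FiniteDimensional.of_surjective
      (LinearMap.snd ℝ (Model d) h.complement) LinearMap.snd_surjective
  have hrank : Module.finrank ℝ h.complement = n - d := by
    have h1 := h.equiv.toLinearEquiv.finrank_eq
    rw [Module.finrank_prod, finrank_euclideanSpace_fin, finrank_euclideanSpace_fin] at h1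
    omega
  let e : h.complement ≃L[ℝ] Model (n - d) :=
    ContinuousLinearEquiv.ofFinrankEq (by rw [hrank, finrank_euclideanSpace_fin])
  let E : Model n ≃L[ℝ] Model d × Model (n - d) :=
    h.equiv.trans ((ContinuousLinearEquiv.refl ℝ (Model d)).prodCongr e)
  let φ := h.domChart
  let ψ := h.codChart
  have hψ : ∀ u ∈ φ.target, (E u).1 = ψ (proj (φ.symm u)) := by
    intro u hu
    have := h.writtenInCharts (show u ∈ (h.domChart.extend (𝓡 n)).target by simpa using hu)
    simpa [E] using this.symm
  have hsrc : ∀ a ∈ φ.source, proj a ∈ ψ.source := fun a ha => h.source_subset_preimage_source ha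
  let C : OpenPartialHomeomorph N (M × Model (n - d)) :=
    (φ.trans E.toHomeomorph.toOpenPartialHomeomorph).trans
      (ψ.symm.prod (OpenPartialHomeomorph.refl (Model (n - d))))
  have hCs : C.source ⊆ φ.source := fun a ha => by
    simp only [C, OpenPartialHomeomorph.trans_source, Set.mem_inter_iff] at ha
    exact ha.1.1
  have hCsrc : C.source = φ.source := by
    refine hCs.antisymm fun a ha => ?_
    have h1 := hψ (φ a) (φ.map_source ha)
    rw [φ.left_inv ha] at h1
    simp [C, ha, h1, ψ.map_source (hsrc a ha)]
  have hC : ∀ a, C a = (ψ.symm (E (φ a)).1, (E (φ a)).2) := fun a => rfl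
  have hCsymm : ∀ p, C.symm p = φ.symm (E.symm (ψ p.1, p.2)) := fun p => rfl
  have hCt : ∀ p ∈ C.target, p.1 ∈ ψ.source ∧ E.symm (ψ p.1, p.2) ∈ φ.target := by
    intro p hp
    have h1 : C.symm p ∈ φ.source := hCs (C.map_target hp)
    simp only [C, OpenPartialHomeomorph.trans_target, Set.mem_inter_iff] at hp
    refine ⟨by simpa using hp.1, ?_⟩
    have := hp.2
    simp only [Set.mem_inter_iff, Set.mem_preimage] at this
    exact this.2
  refine ⟨⟨C, ?_, ?_, ?_⟩, by rw [hCsrc]; exact h.mem_domChart_source⟩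
  · intro a ha
    have ha' := hCs ha
    rw [hC]
    have h1 := hψ (φ a) (φ.map_source ha')
    rw [φ.left_inv ha'] at h1
    simp only [h1]
    exact ψ.left_inv (hsrc a ha')
  · have hφ : ContMDiffOn (𝓡 n) (𝓡 n) ∞ φ φ.source :=
      contMDiffOn_of_mem_maximalAtlas h.domChart_mem_maximalAtlas
    have hψs : ContMDiffOn (𝓡 d) (𝓡 d) ∞ ψ.symm ψ.target :=
      contMDiffOn_symm_of_mem_maximalAtlas h.codChart_mem_maximalAtlas
    have hE : ContMDiffOn (𝓡 n) 𝓘(ℝ, Model d × Model (n - d)) ∞ (fun a => E (φ a)) C.source :=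
      E.contDiff.contMDiff.comp_contMDiffOn (hφ.mono hCs)
    have h1 : ContMDiffOn (𝓡 n) (𝓡 d) ∞ (fun a => (E (φ a)).1) C.source :=
      (ContinuousLinearMap.fst ℝ (Model d) (Model (n - d))).contDiff.contMDiff.comp_contMDiffOn hE
    have h2 : ContMDiffOn (𝓡 n) (𝓡 (n - d)) ∞ (fun a => (E (φ a)).2) C.source :=
      (ContinuousLinearMap.snd ℝ (Model d) (Model (n - d))).contDiff.contMDiff.comp_contMDiffOn hE
    refine ContMDiffOn.prodMk (hψs.comp h1 ?_) h2
    intro a ha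
    have h3 := hψ (φ a) (φ.map_source (hCs ha))
    rw [φ.left_inv (hCs ha)] at h3
    change (E (φ a)).1 ∈ ψ.target
    rw [h3]
    exact ψ.map_source (hsrc a (hCs ha))
  · have hφ : ContMDiffOn (𝓡 n) (𝓡 n) ∞ φ.symm φ.target :=
      contMDiffOn_symm_of_mem_maximalAtlas h.domChart_mem_maximalAtlas
    have hψs : ContMDiffOn (𝓡 d) (𝓡 d) ∞ ψ ψ.source :=
      contMDiffOn_of_mem_maximalAtlas h.codChart_mem_maximalAtlas
    have h1 : ContMDiffOn ((𝓡 d).prod (𝓡 (n - d))) 𝓘(ℝ, Model d × Model (n - d)) ∞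
        (fun p : M × Model (n - d) => (ψ p.1, p.2)) C.target :=
      (hψs.comp contMDiffOn_fst fun p hp => (hCt p hp).1).prodMk_space contMDiffOn_snd
    exact hφ.comp (E.symm.contDiff.contMDiff.comp_contMDiffOn h1) fun p hp => (hCt p hp).2

namespace SliceChart

variable {proj : N → M} (Φ : SliceChart (d := d) (n := n) k proj)

theorem chart_eq {g : N} (hg : g ∈ Φ.chart.source) : Φ.chart g = (proj g, (Φ.chart g).2) :=
  Prod.ext (Φ.fst_eq g hg) rfl

theorem mem_target {g : N} (hg : g ∈ Φ.chart.source) :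
    (proj g, (Φ.chart g).2) ∈ Φ.chart.target := by
  rw [← Φ.chart_eq hg]
  exact Φ.chart.map_source hg

theorem symm_snd {g : N} (hg : g ∈ Φ.chart.source) :
    Φ.chart.symm (proj g, (Φ.chart g).2) = g := by
  rw [← Φ.chart_eq hg]
  exact Φ.chart.left_inv hg

theorem proj_symm {p : M × Model k} (hp : p ∈ Φ.chart.target) : proj (Φ.chart.symm p) = p.1 := by
  rw [← Φ.fst_eq _ (Φ.chart.map_target hp), Φ.chart.right_inv hp]

theorem chart_symm_snd {p : M × Model k} (hp : p ∈ Φ.chart.target) :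
    (Φ.chart (Φ.chart.symm p)).2 = p.2 := by
  rw [Φ.chart.right_inv hp]

theorem contMDiffAt {g : N} (hg : g ∈ Φ.chart.source) :
    ContMDiffAt (𝓡 n) ((𝓡 d).prod (𝓡 k)) ∞ Φ.chart g :=
  Φ.smooth.contMDiffAt (Φ.chart.open_source.mem_nhds hg)

theorem contMDiffAt_snd {g : N} (hg : g ∈ Φ.chart.source) :
    ContMDiffAt (𝓡 n) (𝓡 k) ∞ (fun a => (Φ.chart a).2) g :=
  (Φ.contMDiffAt hg).snd

theorem contMDiffAt_symm {p : M × Model k} (hp : p ∈ Φ.chart.target) :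
    ContMDiffAt ((𝓡 d).prod (𝓡 k)) (𝓡 n) ∞ Φ.chart.symm p :=
  Φ.smooth_symm.contMDiffAt (Φ.chart.open_target.mem_nhds hp)

/-- The slice of the target of a slice chart over a point of the base. -/
def slice (x : M) : Set (Model k) := {y | (x, y) ∈ Φ.chart.target}

theorem isOpen_slice (x : M) : IsOpen (Φ.slice x) :=
  Φ.chart.open_target.preimage (Continuous.prodMk_right x)

end SliceChart

end SliceChart

/-! ### Smooth bundles of compact Lie groups -/

/-- A smooth bundle of compact groups over (an open subset of) `M`. The multiplication is a total
function which is meaningful on pairs of points of the same fibre only. -/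
structure SmoothGroupBundle (d n : ℕ) (M : Type u) [TopologicalSpace M] [ChartedSpace (Model d) M]
    (N : Type v) [TopologicalSpace N] [ChartedSpace (Model n) N] where
  proj : N → M
  mul : N → N → N
  one : M → N
  inv : N → N
  proj_mul : ∀ {a b}, proj a = proj b → proj (mul a b) = proj b
  proj_one : ∀ g, proj (one (proj g)) = proj g
  proj_inv : ∀ g, proj (inv g) = proj g
  protected mul_assoc : ∀ {a b c}, proj a = proj b → proj b = proj c →
    mul (mul a b) c = mul a (mul b c)
  protected one_mul : ∀ g, mul (one (proj g)) g = g
  protected mul_one : ∀ g, mul g (one (proj g)) = g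
  protected inv_mul : ∀ g, mul (inv g) g = one (proj g)
  protected mul_inv : ∀ g, mul g (inv g) = one (proj g)
  submersion : Manifold.IsSubmersion (𝓡 n) (𝓡 d) ∞ proj
  smooth_one : ∀ g, ContMDiffAt (𝓡 d) (𝓡 n) ∞ one (proj g)
  smooth_inv : ContMDiff (𝓡 n) (𝓡 n) ∞ inv
  smooth_mul : ∀ {a b}, proj a = proj b → ∃ f : N × N → N,
    ContMDiffAt ((𝓡 n).prod (𝓡 n)) (𝓡 n) ∞ f (a, b) ∧
      ∀ᶠ p in 𝓝 (a, b), proj p.1 = proj p.2 → f p = mul p.1 p.2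
  isCompact_preimage : ∀ K : Set M, IsCompact K → IsCompact (proj ⁻¹' K)

namespace SmoothGroupBundle

variable {d n k : ℕ} {M : Type u} [TopologicalSpace M] [ChartedSpace (Model d) M]
  {N : Type v} [TopologicalSpace N] [ChartedSpace (Model n) N] (Γ : SmoothGroupBundle d n M N)

theorem contMDiff_proj [IsManifold (𝓡 d) ∞ M] [IsManifold (𝓡 n) ∞ N] :
    ContMDiff (𝓡 n) (𝓡 d) ∞ Γ.proj := Γ.submersion.contMDiff

section

variable {E' : Type*} [NormedAddCommGroup E'] [NormedSpace ℝ E'] {H' : Type*} [TopologicalSpace H']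
  {J : ModelWithCorners ℝ E' H'} {P : Type*} [TopologicalSpace P] [ChartedSpace H' P]

/-- The multiplication is smooth only along composable pairs, through local extensions; composing
with maps into these pairs hides the extension. -/
theorem contMDiffAt_mul {a b : P → N} {p : P} (ha : ContMDiffAt J (𝓡 n) ∞ a p)
    (hb : ContMDiffAt J (𝓡 n) ∞ b p) (hab : ∀ᶠ q in 𝓝 p, Γ.proj (a q) = Γ.proj (b q)) :
    ContMDiffAt J (𝓡 n) ∞ (fun q => Γ.mul (a q) (b q)) p := by
  obtain ⟨f, hf, hfm⟩ := Γ.smooth_mul hab.self_of_nhds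
  have hc : ContinuousAt (fun q => (a q, b q)) p := ha.continuousAt.prodMk hb.continuousAt
  refine (ContMDiffAt.comp p (g := f) (f := fun q => (a q, b q)) hf
    (ha.prodMk hb)).congr_of_eventuallyEq ?_
  filter_upwards [hab, hc.eventually hfm] with q h1 h2
  exact (h2 h1).symm

theorem contMDiffAt_inv {a : P → N} {p : P} (ha : ContMDiffAt J (𝓡 n) ∞ a p) :
    ContMDiffAt J (𝓡 n) ∞ (fun q => Γ.inv (a q)) p :=
  (Γ.smooth_inv _).comp p ha

end

protected theorem inv_mul_cancel_left {a b : N} (h : Γ.proj a = Γ.proj b) :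
    Γ.mul (Γ.inv a) (Γ.mul a b) = b := by
  rw [← Γ.mul_assoc (Γ.proj_inv a) h, Γ.inv_mul, h, Γ.one_mul]

protected theorem mul_inv_cancel_right {a b : N} (h : Γ.proj a = Γ.proj b) :
    Γ.mul (Γ.mul a b) (Γ.inv b) = a := by
  rw [Γ.mul_assoc h (Γ.proj_inv b).symm, Γ.mul_inv, ← h, Γ.mul_one]

protected theorem inv_inv (a : N) : Γ.inv (Γ.inv a) = a := by
  calc Γ.inv (Γ.inv a) = Γ.mul (Γ.inv (Γ.inv a)) (Γ.mul (Γ.inv a) a) := by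
        rw [Γ.inv_mul, ← Γ.proj_inv a, ← Γ.proj_inv (Γ.inv a), Γ.mul_one]
    _ = a := Γ.inv_mul_cancel_left (Γ.proj_inv a)

end SmoothGroupBundle

theorem ContinuousLinearMap.det_comp {k : ℕ} (A B : Model k →L[ℝ] Model k) :
    (A.comp B).det = A.det * B.det := by
  simp only [ContinuousLinearMap.det, ContinuousLinearMap.toLinearMap_comp, LinearMap.det_comp]

namespace SmoothGroupBundle

/-! ### Left translations in slice charts and the left-invariant density -/

section Translation

variable {d n k : ℕ} {M : Type u} [TopologicalSpace M] [ChartedSpace (Model d) M]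
  {N : Type v} [TopologicalSpace N] [ChartedSpace (Model n) N] (Γ : SmoothGroupBundle d n M N)
  (Φ Φ₁ Φ₂ : SliceChart (d := d) (n := n) k Γ.proj)

/-- The left translation by `h`, written in two slice charts. -/
def translation (h : N) (y : Model k) : Model k :=
  (Φ₂.chart (Γ.mul h (Φ₁.chart.symm (Γ.proj h, y)))).2

/-- The domain of a left translation, written in two slice charts. -/
def translationDomain (h : N) : Set (Model k) :=
  {y | (Γ.proj h, y) ∈ Φ₁.chart.target ∧ Γ.mul h (Φ₁.chart.symm (Γ.proj h, y)) ∈ Φ₂.chart.source}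

/-- The derivative at the unit of the left translation by `g`. -/
def translationDeriv (g : N) : Model k →L[ℝ] Model k :=
  fderiv ℝ (Γ.translation Φ₁ Φ₂ g) (Φ₁.chart (Γ.one (Γ.proj g))).2

variable {Γ Φ Φ₁ Φ₂}

theorem one_mem_translationDomain {g : N} (h1 : Γ.one (Γ.proj g) ∈ Φ₁.chart.source)
    (hg : g ∈ Φ₂.chart.source) :
    (Φ₁.chart (Γ.one (Γ.proj g))).2 ∈ Γ.translationDomain Φ₁ Φ₂ g := by
  have h2 := Φ₁.mem_target h1
  have h3 := Φ₁.symm_snd h1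
  rw [Γ.proj_one] at h2 h3
  exact ⟨h2, by rwa [h3, Γ.mul_one]⟩

theorem translation_one {g : N} (h1 : Γ.one (Γ.proj g) ∈ Φ₁.chart.source) :
    Γ.translation Φ₁ Φ₂ g (Φ₁.chart (Γ.one (Γ.proj g))).2 = (Φ₂.chart g).2 := by
  have h3 := Φ₁.symm_snd h1
  rw [Γ.proj_one] at h3
  rw [translation, h3, Γ.mul_one]

theorem symm_translation {h : N} {y : Model k} (hy : y ∈ Γ.translationDomain Φ₁ Φ₂ h) :
    Φ₂.chart.symm (Γ.proj h, Γ.translation Φ₁ Φ₂ h y) =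
      Γ.mul h (Φ₁.chart.symm (Γ.proj h, y)) := by
  have h1 := Φ₂.symm_snd hy.2
  rwa [Γ.proj_mul (Φ₁.proj_symm hy.1).symm, Φ₁.proj_symm hy.1] at h1

theorem translation_mem_target {h : N} {y : Model k} (hy : y ∈ Γ.translationDomain Φ₁ Φ₂ h) :
    (Γ.proj h, Γ.translation Φ₁ Φ₂ h y) ∈ Φ₂.chart.target := by
  have h1 := Φ₂.mem_target hy.2
  rwa [Γ.proj_mul (Φ₁.proj_symm hy.1).symm, Φ₁.proj_symm hy.1] at h1

theorem translation_translation {g h : N} (hg : Γ.proj h = Γ.proj g) {y : Model k}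
    (hy : y ∈ Γ.translationDomain Φ Φ₁ g) :
    Γ.translation Φ₁ Φ₂ h (Γ.translation Φ Φ₁ g y) = Γ.translation Φ Φ₂ (Γ.mul h g) y := by
  rw [translation, hg, symm_translation hy, translation, Γ.proj_mul hg,
    Γ.mul_assoc hg (Φ.proj_symm hy.1).symm]

theorem translation_inv_mem {h : N} {y : Model k} (hy : y ∈ Γ.translationDomain Φ₁ Φ₂ h) :
    Γ.translation Φ₁ Φ₂ h y ∈ Γ.translationDomain Φ₂ Φ₁ (Γ.inv h) := by
  refine ⟨by rw [Γ.proj_inv]; exact translation_mem_target hy, ?_⟩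
  rw [Γ.proj_inv, symm_translation hy, Γ.inv_mul_cancel_left (Φ₁.proj_symm hy.1).symm]
  exact Φ₁.chart.map_target hy.1

theorem translation_inv_translation {h : N} {y : Model k}
    (hy : y ∈ Γ.translationDomain Φ₁ Φ₂ h) :
    Γ.translation Φ₂ Φ₁ (Γ.inv h) (Γ.translation Φ₁ Φ₂ h y) = y := by
  rw [translation, Γ.proj_inv, symm_translation hy,
    Γ.inv_mul_cancel_left (Φ₁.proj_symm hy.1).symm, Φ₁.chart_symm_snd hy.1]

variable [IsManifold (𝓡 d) ∞ M] [IsManifold (𝓡 n) ∞ N]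

theorem contMDiffAt_symm_proj {g : N} {y : Model k} (hy : (Γ.proj g, y) ∈ Φ.chart.target) :
    ContMDiffAt ((𝓡 n).prod (𝓡 k)) (𝓡 n) ∞
      (fun p : N × Model k => Φ.chart.symm (Γ.proj p.1, p.2)) (g, y) := by
  have h1 : ContMDiffAt ((𝓡 n).prod (𝓡 k)) ((𝓡 d).prod (𝓡 k)) ∞
      (fun p : N × Model k => (Γ.proj p.1, p.2)) (g, y) :=
    ((Γ.contMDiff_proj _).comp _ contMDiffAt_fst).prodMk contMDiffAt_snd
  exact ContMDiffAt.comp (g, y) (g := Φ.chart.symm) (Φ.contMDiffAt_symm hy) h1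

theorem eventually_symm_proj {g : N} {y : Model k} (hy : (Γ.proj g, y) ∈ Φ.chart.target) :
    ∀ᶠ p : N × Model k in 𝓝 (g, y), (Γ.proj p.1, p.2) ∈ Φ.chart.target := by
  have h1 : Continuous (fun p : N × Model k => (Γ.proj p.1, p.2)) :=
    (Γ.contMDiff_proj.continuous.comp continuous_fst).prodMk continuous_snd
  exact h1.continuousAt.eventually (Φ.chart.open_target.mem_nhds hy)

theorem contMDiffAt_mul_symm {h : N} {y : Model k} (hy : (Γ.proj h, y) ∈ Φ.chart.target) :
    ContMDiffAt ((𝓡 n).prod (𝓡 k)) (𝓡 n) ∞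
      (fun p : N × Model k => Γ.mul p.1 (Φ.chart.symm (Γ.proj p.1, p.2))) (h, y) := by
  refine Γ.contMDiffAt_mul contMDiffAt_fst (contMDiffAt_symm_proj hy) ?_
  filter_upwards [eventually_symm_proj hy] with p hp
  exact (Φ.proj_symm hp).symm

theorem contMDiffAt_translation {h : N} {y : Model k} (hy : y ∈ Γ.translationDomain Φ₁ Φ₂ h) :
    ContMDiffAt ((𝓡 n).prod (𝓡 k)) (𝓡 k) ∞
      (fun p : N × Model k => Γ.translation Φ₁ Φ₂ p.1 p.2) (h, y) :=
  ContMDiffAt.comp (h, y) (g := fun a => (Φ₂.chart a).2) (Φ₂.contMDiffAt_snd hy.2)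
    (contMDiffAt_mul_symm hy.1)

theorem contDiffAt_translation {h : N} {y : Model k} (hy : y ∈ Γ.translationDomain Φ₁ Φ₂ h) :
    ContDiffAt ℝ ∞ (Γ.translation Φ₁ Φ₂ h) y := by
  rw [← contMDiffAt_iff_contDiffAt]
  exact ContMDiffAt.comp y (g := fun p : N × Model k => Γ.translation Φ₁ Φ₂ p.1 p.2)
    (f := fun y => (h, y)) (contMDiffAt_translation hy) (contMDiffAt_const.prodMk contMDiffAt_id)

theorem differentiableAt_translation {h : N} {y : Model k}
    (hy : y ∈ Γ.translationDomain Φ₁ Φ₂ h) :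
    DifferentiableAt ℝ (Γ.translation Φ₁ Φ₂ h) y :=
  (contDiffAt_translation hy).differentiableAt (by simp)

theorem isOpen_translationDomain (h : N) : IsOpen (Γ.translationDomain Φ₁ Φ₂ h) := by
  rw [isOpen_iff_mem_nhds]
  intro y hy
  have h1 : ContinuousAt (fun y : Model k => Γ.mul h (Φ₁.chart.symm (Γ.proj h, y))) y :=
    ContinuousAt.comp (g := fun p : N × Model k => Γ.mul p.1 (Φ₁.chart.symm (Γ.proj p.1, p.2)))
      (f := fun y => (h, y)) (contMDiffAt_mul_symm hy.1).continuousAt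
      (Continuous.prodMk_right h).continuousAt
  filter_upwards [(Φ₁.isOpen_slice (Γ.proj h)).mem_nhds hy.1,
    h1.eventually (Φ₂.chart.open_source.mem_nhds hy.2)] with z hz1 hz2
  exact ⟨hz1, hz2⟩

/-- The unit at which the derivative is taken moves with `g`; joint smoothness of the translation in
`(g, y)` allows both to vary. -/
theorem contMDiffAt_translationDeriv {g : N} (h1 : Γ.one (Γ.proj g) ∈ Φ₁.chart.source)
    (hg : g ∈ Φ₂.chart.source) :
    ContMDiffAt (𝓡 n) 𝓘(ℝ, Model k →L[ℝ] Model k) ∞ (Γ.translationDeriv Φ₁ Φ₂) g := by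
  have hone : ContMDiffAt (𝓡 n) (𝓡 k) ∞ (fun a => (Φ₁.chart (Γ.one (Γ.proj a))).2) g := by
    have h2 : ContMDiffAt (𝓡 n) (𝓡 n) ∞ (fun a => Γ.one (Γ.proj a)) g :=
      (Γ.smooth_one g).comp g (Γ.contMDiff_proj g)
    exact ContMDiffAt.comp g (g := fun a => (Φ₁.chart a).2) (Φ₁.contMDiffAt_snd h1) h2
  have := ContMDiffAt.mfderiv (Γ.translation Φ₁ Φ₂) (fun a => (Φ₁.chart (Γ.one (Γ.proj a))).2)
    (m := ∞) (contMDiffAt_translation (one_mem_translationDomain h1 hg)) hone (by simp)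
  refine this.congr_of_eventuallyEq (Filter.Eventually.of_forall fun a => ?_)
  refine Eq.trans ?_ (congrFun (inTangentCoordinates_model_space (I := 𝓡 k) (I' := 𝓡 k)
    (fun a => (Φ₁.chart (Γ.one (Γ.proj a))).2)
    (fun a => Γ.translation Φ₁ Φ₂ a (Φ₁.chart (Γ.one (Γ.proj a))).2)
    (fun a => mfderiv (𝓡 k) (𝓡 k) (Γ.translation Φ₁ Φ₂ a)
      (Φ₁.chart (Γ.one (Γ.proj a))).2) g) a).symm
  exact mfderiv_eq_fderiv.symm

/-- Chain rule at the unit for the composite of the translations by `g` and by `h`. -/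
theorem translationDeriv_mul {g h : N} (hg : Γ.proj h = Γ.proj g)
    (h1 : Γ.one (Γ.proj g) ∈ Φ.chart.source) (h2 : g ∈ Φ₁.chart.source)
    (h3 : Γ.mul h g ∈ Φ₂.chart.source) :
    Γ.translationDeriv Φ Φ₂ (Γ.mul h g) =
      (fderiv ℝ (Γ.translation Φ₁ Φ₂ h) (Φ₁.chart g).2).comp (Γ.translationDeriv Φ Φ₁ g) := by
  have hd := one_mem_translationDomain h1 h2
  have hd' : (Φ₁.chart g).2 ∈ Γ.translationDomain Φ₁ Φ₂ h := by
    refine ⟨?_, ?_⟩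
    · rw [hg]; exact Φ₁.mem_target h2
    · rwa [hg, Φ₁.symm_snd h2]
  rw [← translation_one (Φ₂ := Φ₁) h1] at hd' ⊢
  have hev : (fun y => Γ.translation Φ₁ Φ₂ h (Γ.translation Φ Φ₁ g y)) =ᶠ[
      𝓝 (Φ.chart (Γ.one (Γ.proj g))).2] Γ.translation Φ Φ₂ (Γ.mul h g) := by
    filter_upwards [(isOpen_translationDomain g).mem_nhds hd] with y hy
    exact translation_translation hg hy
  rw [translationDeriv, translationDeriv, Γ.proj_mul hg, ← hev.fderiv_eq]
  exact fderiv_comp (g := Γ.translation Φ₁ Φ₂ h) _ (differentiableAt_translation hd')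
    (differentiableAt_translation hd)

theorem translationDeriv_one {g : N} (h1 : Γ.one (Γ.proj g) ∈ Φ.chart.source) :
    Γ.translationDeriv Φ Φ (Γ.one (Γ.proj g)) = ContinuousLinearMap.id ℝ (Model k) := by
  have h1' : Γ.one (Γ.proj (Γ.one (Γ.proj g))) ∈ Φ.chart.source := by rwa [Γ.proj_one]
  have hev : Γ.translation Φ Φ (Γ.one (Γ.proj g)) =ᶠ[
      𝓝 (Φ.chart (Γ.one (Γ.proj (Γ.one (Γ.proj g))))).2] id := by
    filter_upwards [(isOpen_translationDomain _).mem_nhds (one_mem_translationDomain h1' h1)]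
      with y hy
    have h2 := Φ.proj_symm hy.1
    have h3 := Γ.one_mul (Φ.chart.symm (Γ.proj (Γ.one (Γ.proj g)), y))
    rw [h2, Γ.proj_one] at h3
    rw [translation, Γ.proj_one, h3, ← Γ.proj_one g]
    exact Φ.chart_symm_snd hy.1
  rw [translationDeriv, hev.fderiv_eq, fderiv_id]

/-- The chain rule for `g⁻¹ g = 1` provides a left inverse of the derivative. -/
theorem det_translationDeriv_ne_zero {g : N} (h1 : Γ.one (Γ.proj g) ∈ Φ.chart.source)
    (h2 : g ∈ Φ₁.chart.source) : (Γ.translationDeriv Φ Φ₁ g).det ≠ 0 := by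
  have h3 := translationDeriv_mul (Φ := Φ) (Φ₁ := Φ₁) (Φ₂ := Φ) (Γ.proj_inv g) h1 h2
    (by rwa [Γ.inv_mul])
  rw [Γ.inv_mul, translationDeriv_one h1] at h3
  intro h0
  have h4 := congrArg ContinuousLinearMap.det h3
  have h5 : (ContinuousLinearMap.id ℝ (Model k)).det = 1 := by
    simp [ContinuousLinearMap.det]
  rw [h5, ContinuousLinearMap.det_comp, h0, mul_zero] at h4
  exact one_ne_zero h4

end Translation

end SmoothGroupBundle

/-- By the Leibniz formula the determinant is a polynomial in the matrix entries. -/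
theorem contDiff_continuousLinearMap_det (k : ℕ) :
    ContDiff ℝ ∞ (fun A : Model k →L[ℝ] Model k => A.det) := by
  let b := (EuclideanSpace.basisFun (Fin k) ℝ).toBasis
  have h : (fun A : Model k →L[ℝ] Model k => A.det) = fun A => ∑ σ : Equiv.Perm (Fin k),
      ((Equiv.Perm.sign σ : ℤ) : ℝ) * ∏ i, b.repr (A (b i)) (σ i) := by
    funext A
    rw [ContinuousLinearMap.det, ← LinearMap.det_toMatrix b, Matrix.det_apply]
    refine Finset.sum_congr rfl fun σ _ => ?_
    rw [Units.smul_def, zsmul_eq_mul]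
    simp [LinearMap.toMatrix_apply]
  rw [h]
  refine ContDiff.sum fun σ _ => contDiff_const.mul (contDiff_prod fun i _ => ?_)
  have : (fun A : Model k →L[ℝ] Model k => b.repr (A (b i)) (σ i)) =
      fun A => (EuclideanSpace.proj (𝕜 := ℝ) (σ i) : Model k →L[ℝ] ℝ) (A (b i)) := by
    funext A
    simp [b]
  rw [this]
  exact (ContinuousLinearMap.contDiff _).comp (contDiff_id.clm_apply contDiff_const)

/-! ### Integrals depending smoothly on a parameter -/

section ParametricIntegral

open MeasureTheory

/-- After the reflection `y ↦ -y`, the integral is the value at `0` of the convolution of the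
constant `1` with the integrand. Convolutions with a smooth, uniformly compactly supported family
are smooth in the parameter, which is read in a chart of `N`. -/
theorem contMDiffAt_parametric_integral {n k : ℕ} {N : Type*} [TopologicalSpace N]
    [ChartedSpace (Model n) N] [IsManifold (𝓡 n) ∞ N]
    {V : Type*} [NormedAddCommGroup V] [NormedSpace ℝ V]
    {U : N → Model k → V} {g₀ : N} {O : Set N} (hO : IsOpen O) (hg₀ : g₀ ∈ O)
    {C : Set (Model k)} (hC : IsCompact C) (hU : ∀ g ∈ O, ∀ y ∉ C, U g y = 0)
    (hsmooth : ∀ g ∈ O, ∀ y,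
      ContMDiffAt ((𝓡 n).prod (𝓡 k)) 𝓘(ℝ, V) ∞ (fun p : N × Model k => U p.1 p.2) (g, y)) :
    ContMDiffAt (𝓡 n) 𝓘(ℝ, V) ∞ (fun g => ∫ y, U g y) g₀ := by
  let e := extChartAt (𝓡 n) g₀
  let s : Set (Model n) := e.target ∩ e.symm ⁻¹' O
  have hs : IsOpen s :=
    (continuousOn_extChartAt_symm (I := 𝓡 n) g₀).isOpen_inter_preimage
      (isOpen_extChartAt_target g₀) hO
  have hsm : ContDiffOn ℝ ∞ (fun q : Model n × Model k => U (e.symm q.1) q.2)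
      (s ×ˢ Set.univ) := by
    rintro ⟨p, y⟩ ⟨⟨hp1, hp2⟩, -⟩
    refine ContDiffAt.contDiffWithinAt ?_
    rw [← contMDiffAt_iff_contDiffAt, modelWithCornersSelf_prod, ← chartedSpaceSelf_prod]
    have h1 : ContMDiffAt (𝓡 n) (𝓡 n) ∞ e.symm p :=
      (contMDiffOn_extChartAt_symm g₀).contMDiffAt ((isOpen_extChartAt_target g₀).mem_nhds hp1)
    have h2 : ContMDiffAt ((𝓡 n).prod (𝓡 k)) ((𝓡 n).prod (𝓡 k)) ∞
        (fun q : Model n × Model k => (e.symm q.1, q.2)) (p, y) :=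
      (ContMDiffAt.comp (p, y) (g := e.symm) (f := Prod.fst) h1 contMDiffAt_fst).prodMk
        contMDiffAt_snd
    exact ContMDiffAt.comp (p, y) (g := fun p : N × Model k => U p.1 p.2) (hsmooth _ hp2 y) h2
  have hconv := contDiffOn_convolution_right_with_param (μ := (volume : Measure (Model k)))
    (f := fun _ => (1 : ℝ)) (n := ⊤) (ContinuousLinearMap.lsmul ℝ ℝ : ℝ →L[ℝ] V →L[ℝ] V)
    (g := fun p y => U (e.symm p) y) hs hC (fun p y hp hy => hU _ hp.2 y hy)
    (locallyIntegrable_const 1) hsm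
  have hint : ∀ p, ∫ y, U (e.symm p) y =
      MeasureTheory.convolution (fun _ => (1 : ℝ)) (fun y => U (e.symm p) y)
        (ContinuousLinearMap.lsmul ℝ ℝ : ℝ →L[ℝ] V →L[ℝ] V) volume 0 := by
    intro p
    rw [convolution_def, ← integral_neg_eq_self]
    simp
  have hg₀s : e g₀ ∈ s := ⟨mem_extChartAt_target g₀, by
    simpa [e, Set.mem_preimage, extChartAt_to_inv] using hg₀⟩
  have hF : ContDiffAt ℝ ∞ (fun p => ∫ y, U (e.symm p) y) (e g₀) := by
    have h1 := hconv.contDiffAt (x := (e g₀, (0 : Model k)))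
      ((hs.prod isOpen_univ).mem_nhds ⟨hg₀s, trivial⟩)
    have h2 : ContDiffAt ℝ ∞ (fun p : Model n => (p, (0 : Model k))) (e g₀) :=
      contDiffAt_id.prodMk contDiffAt_const
    refine (ContDiffAt.comp (e g₀) (f := fun p : Model n => (p, (0 : Model k)))
      h1 h2).congr_of_eventuallyEq (Filter.Eventually.of_forall fun p => ?_)
    exact hint p
  have h3 : ContMDiffAt (𝓡 n) 𝓘(ℝ, V) ∞ (fun g => ∫ y, U (e.symm (e g)) y) g₀ :=
    ContMDiffAt.comp g₀ (g := fun p => ∫ y, U (e.symm p) y) hF.contMDiffAt contMDiffAt_extChartAt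
  refine h3.congr_of_eventuallyEq ?_
  filter_upwards [extChartAt_source_mem_nhds (I := 𝓡 n) g₀] with g hg
  simp only [e, (extChartAt (𝓡 n) g₀).left_inv hg]

end ParametricIntegral

/-! ### Partitions of unity and left-invariant densities on the fibres. -/

namespace SmoothGroupBundle

variable {d n k : ℕ} {M : Type u} [TopologicalSpace M] [ChartedSpace (Model d) M]
  {N : Type v} [TopologicalSpace N] [ChartedSpace (Model n) N]

/-- A partition of unity subordinate to a family of slice charts. -/
structure SlicePartition (Γ : SmoothGroupBundle d n M N) (k : ℕ) where
  ι : Type v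
  Φ : ι → SliceChart (d := d) (n := n) k Γ.proj
  χ : SmoothPartitionOfUnity ι (𝓡 n) N Set.univ
  subordinate : χ.IsSubordinate fun i => (Φ i).chart.source

theorem exists_slicePartition [IsManifold (𝓡 d) ∞ M] [IsManifold (𝓡 n) ∞ N] [T2Space N]
    [SigmaCompactSpace N] (Γ : SmoothGroupBundle d n M N) :
    Nonempty (Γ.SlicePartition (n - d)) := by
  choose Φ hΦ using fun g : N => exists_sliceChart (Γ.submersion.isSubmersionAt g)
  obtain ⟨χ, hχ⟩ := SmoothPartitionOfUnity.exists_isSubordinate (𝓡 n) isClosed_univ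
    (fun g => (Φ g).chart.source) (fun g => (Φ g).chart.open_source)
    (fun g _ => Set.mem_iUnion.2 ⟨g, hΦ g⟩)
  exact ⟨⟨N, Φ, χ, hχ⟩⟩

namespace SlicePartition

variable {Γ : SmoothGroupBundle d n M N} (A : Γ.SlicePartition k)

theorem mem_source {i : A.ι} {g : N} (h : g ∈ tsupport (A.χ i)) : g ∈ (A.Φ i).chart.source :=
  A.subordinate i h

theorem mem_source_of_ne {i : A.ι} {g : N} (h : A.χ i g ≠ 0) : g ∈ (A.Φ i).chart.source :=
  A.mem_source (subset_tsupport _ h)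

/-- The density, in the slice chart `A.Φ i`, of the left-invariant measures on the fibres which
are normalized at the units by means of the slice charts. -/
def density (i : A.ι) (g : N) : ℝ :=
  ∑ᶠ j, A.χ j (Γ.one (Γ.proj g)) * |(Γ.translationDeriv (A.Φ j) (A.Φ i) g).det|⁻¹

variable [IsManifold (𝓡 d) ∞ M] [IsManifold (𝓡 n) ∞ N]

/-- The weights see only the unit of the fibre, which translation by `h` does not change, and by the
chain rule every summand acquires the same Jacobian factor. -/
theorem density_mul {i i' : A.ι} {g h : N} (hg : Γ.proj h = Γ.proj g)
    (h1 : g ∈ (A.Φ i).chart.source) (h2 : Γ.mul h g ∈ (A.Φ i').chart.source) :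
    A.density i g = |(fderiv ℝ (Γ.translation (A.Φ i) (A.Φ i') h) ((A.Φ i).chart g).2).det| *
      A.density i' (Γ.mul h g) := by
  rw [density, density, ← smul_eq_mul, smul_finsum]
  refine finsum_congr fun j => ?_
  rw [Γ.proj_mul hg, smul_eq_mul]
  by_cases hj : A.χ j (Γ.one (Γ.proj g)) = 0
  · simp [hj]
  have hj' := A.mem_source_of_ne hj
  have hd := det_translationDeriv_ne_zero (Φ₁ := A.Φ i') (g := Γ.mul h g)
    (by rwa [Γ.proj_mul hg]) h2
  have h3 := translationDeriv_mul hg hj' h1 h2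
  rw [h3] at hd ⊢
  rw [ContinuousLinearMap.det_comp] at hd ⊢
  have h5 := abs_pos.2 (left_ne_zero_of_mul hd)
  rw [abs_mul, mul_inv]
  field_simp

theorem density_pos {i : A.ι} {g : N} (h1 : g ∈ (A.Φ i).chart.source) : 0 < A.density i g := by
  have hfin : (Function.support fun j => A.χ j (Γ.one (Γ.proj g)) *
      |(Γ.translationDeriv (A.Φ j) (A.Φ i) g).det|⁻¹).Finite :=
    (A.χ.locallyFinite.point_finite (Γ.one (Γ.proj g))).subset fun j hj => left_ne_zero_of_mul hj
  have hnn : ∀ j, 0 ≤ A.χ j (Γ.one (Γ.proj g)) *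
      |(Γ.translationDeriv (A.Φ j) (A.Φ i) g).det|⁻¹ :=
    fun j => mul_nonneg (A.χ.nonneg j _) (inv_nonneg.2 (abs_nonneg _))
  obtain ⟨j, hj⟩ := A.χ.exists_pos_of_mem (Set.mem_univ (Γ.one (Γ.proj g)))
  refine finsum_pos hnn ⟨j, mul_pos hj (inv_pos.2 (abs_pos.2 ?_))⟩ hfin
  exact det_translationDeriv_ne_zero (A.mem_source_of_ne hj.ne') h1

theorem contMDiffAt_density {i : A.ι} {g : N} (h1 : g ∈ (A.Φ i).chart.source) :
    ContMDiffAt (𝓡 n) 𝓘(ℝ) ∞ (A.density i) g := by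
  have hone : ContMDiffAt (𝓡 n) (𝓡 n) ∞ (fun a => Γ.one (Γ.proj a)) g :=
    (Γ.smooth_one g).comp g (Γ.contMDiff_proj g)
  have hterm : ∀ j, ContMDiffAt (𝓡 n) 𝓘(ℝ) ∞ (fun a => A.χ j (Γ.one (Γ.proj a)) *
      |(Γ.translationDeriv (A.Φ j) (A.Φ i) a).det|⁻¹) g := by
    intro j
    by_cases hj : Γ.one (Γ.proj g) ∈ tsupport (A.χ j)
    · have hj' := A.mem_source hj
      have hd := det_translationDeriv_ne_zero hj' h1
      have h2 : ContMDiffAt (𝓡 n) 𝓘(ℝ) ∞ (fun a => A.χ j (Γ.one (Γ.proj a))) g :=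
        ((A.χ j).contMDiff _).comp g hone
      have h3 : ContDiffAt ℝ ∞ (fun B : Model k →L[ℝ] Model k => |B.det|⁻¹)
          (Γ.translationDeriv (A.Φ j) (A.Φ i) g) :=
        (((contDiff_continuousLinearMap_det k).contDiffAt).abs hd).inv (abs_ne_zero.2 hd)
      exact h2.mul (ContMDiffAt.comp g (g := fun B : Model k →L[ℝ] Model k => |B.det|⁻¹)
        h3.contMDiffAt (contMDiffAt_translationDeriv hj' h1))
    -- Off the support the term vanishes near `g`, so nothing is needed of the derivative there,
    -- where the unit may lie outside the chart.
    · refine (contMDiffAt_const (c := (0 : ℝ))).congr_of_eventuallyEq ?_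
      have h2 := hone.continuousAt.eventually
        ((isClosed_tsupport (A.χ j)).isOpen_compl.mem_nhds hj)
      filter_upwards [h2] with a ha
      rw [image_eq_zero_of_notMem_tsupport ha, zero_mul]
  obtain ⟨t, ht, htf⟩ := A.χ.locallyFinite (Γ.one (Γ.proj g))
  refine (contMDiffAt_finsetSum (t := htf.toFinset) fun j _ => hterm j).congr_of_eventuallyEq ?_
  filter_upwards [hone.continuousAt.eventually ht] with a ha
  rw [density, finsum_eq_sum_of_support_subset]
  · intro j hj
    rw [Set.Finite.coe_toFinset]
    exact ⟨_, left_ne_zero_of_mul hj, ha⟩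

end SlicePartition

end SmoothGroupBundle

/-! ### Left-invariant integration over the fibres -/

namespace SmoothGroupBundle

open MeasureTheory

variable {d n k : ℕ} {M : Type u} [TopologicalSpace M] [ChartedSpace (Model d) M]
  {N : Type v} [TopologicalSpace N] [ChartedSpace (Model n) N]
  {Γ : SmoothGroupBundle d n M N}

namespace SlicePartition

variable (A : Γ.SlicePartition k)
  {V : Type*} [NormedAddCommGroup V] [NormedSpace ℝ V]

/-- The integral of a function over the fibre at `x`, with respect to a left-invariant measure. -/
def fiberIntegral (x : M) (u : N → V) : V :=
  ∑ᶠ i, ∫ y in (A.Φ i).slice x, (A.χ i ((A.Φ i).chart.symm (x, y)) *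
    A.density i ((A.Φ i).chart.symm (x, y))) • u ((A.Φ i).chart.symm (x, y))

/-- Properness: the preimage of a compact neighbourhood of `x₀` is compact, hence meets only
finitely many supports. -/
theorem exists_finset [T2Space M] (x₀ : M) :
    ∃ I : Finset A.ι, ∀ᶠ x in 𝓝 x₀, ∀ g, Γ.proj g = x → ∀ i ∉ I, A.χ i g = 0 := by
  have : LocallyCompactSpace M := ChartedSpace.locallyCompactSpace (Model d) M
  obtain ⟨K, hK, hx⟩ := exists_compact_mem_nhds x₀
  have hfin := A.χ.locallyFinite.finite_nonempty_inter_compact (Γ.isCompact_preimage K hK)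
  refine ⟨hfin.toFinset, ?_⟩
  filter_upwards [hx] with x hxK g hg i hi
  by_contra h
  refine hi ?_
  rw [Set.Finite.mem_toFinset]
  exact ⟨g, h, by rwa [Set.mem_preimage, hg]⟩

variable {A} in
theorem fiberIntegral_eq_sum {I : Finset A.ι} {x : M}
    (hI : ∀ g, Γ.proj g = x → ∀ i ∉ I, A.χ i g = 0) (u : N → V) :
    A.fiberIntegral x u = ∑ i ∈ I, ∫ y in (A.Φ i).slice x, (A.χ i ((A.Φ i).chart.symm (x, y)) *
      A.density i ((A.Φ i).chart.symm (x, y))) • u ((A.Φ i).chart.symm (x, y)) := by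
  refine finsum_eq_sum_of_support_subset _ fun i hi => ?_
  by_contra hiI
  refine hi (setIntegral_eq_zero_of_forall_eq_zero fun y hy => ?_)
  rw [hI _ ((A.Φ i).proj_symm hy) i (by simpa using hiI), zero_mul, zero_smul]

theorem fiberIntegral_congr {x : M} {u u' : N → V} (h : ∀ g, Γ.proj g = x → u g = u' g) :
    A.fiberIntegral x u = A.fiberIntegral x u' := by
  refine finsum_congr fun i => setIntegral_congr_fun ((A.Φ i).isOpen_slice x).measurableSet ?_
  intro y hy
  simp only [h _ ((A.Φ i).proj_symm hy)]

theorem sum_eq_one {I : Finset A.ι} {g : N} (hI : ∀ i ∉ I, A.χ i g = 0) :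
    ∑ i ∈ I, A.χ i g = 1 := by
  rw [← A.χ.sum_eq_one (Set.mem_univ g)]
  refine (finsum_eq_sum_of_support_subset _ fun i hi => ?_).symm
  by_contra hiI
  exact hi (hI i (by simpa using hiI))

/-- A function on the fibre which is supported in the support of `χ i` is integrable in the slice
chart `Φ i`. -/
theorem integrableOn_slice [T2Space M] {V : Type*} [NormedAddCommGroup V] (i : A.ι) (x : M)
    {w : N → V}
    (hw : ContinuousOn w (Γ.proj ⁻¹' {x} ∩ (A.Φ i).chart.source))
    (h0 : ∀ g, Γ.proj g = x → g ∉ tsupport (A.χ i) → w g = 0) :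
    IntegrableOn (fun y => w ((A.Φ i).chart.symm (x, y))) ((A.Φ i).slice x) := by
  have hS : IsCompact (Γ.proj ⁻¹' {x} ∩ tsupport (A.χ i)) :=
    (Γ.isCompact_preimage {x} isCompact_singleton).inter_right (isClosed_tsupport _)
  let C : Set (Model k) :=
    (fun g => ((A.Φ i).chart g).2) '' (Γ.proj ⁻¹' {x} ∩ tsupport (A.χ i))
  have hC : IsCompact C := by
    refine hS.image_of_continuousOn (continuous_snd.comp_continuousOn
      ((A.Φ i).chart.continuousOn.mono fun g hg => A.mem_source hg.2))
  have hCs : C ⊆ (A.Φ i).slice x := by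
    rintro y ⟨g, ⟨rfl, hg⟩, rfl⟩
    exact (A.Φ i).mem_target (A.mem_source hg)
  have hcont : ContinuousOn (fun y => w ((A.Φ i).chart.symm (x, y))) ((A.Φ i).slice x) := by
    refine hw.comp ((A.Φ i).chart.continuousOn_symm.comp
      (Continuous.prodMk_right x).continuousOn fun y hy => hy) fun y hy => ?_
    exact ⟨(A.Φ i).proj_symm hy, (A.Φ i).chart.map_target hy⟩
  refine ((hcont.mono hCs).integrableOn_compact hC).of_forall_sdiff_eq_zero
    ((A.Φ i).isOpen_slice x).measurableSet ?_
  rintro y ⟨hy, hyC⟩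
  refine h0 _ ((A.Φ i).proj_symm hy) fun hg => hyC ?_
  exact ⟨_, ⟨(A.Φ i).proj_symm hy, hg⟩, (A.Φ i).chart_symm_snd hy⟩

/-- A function `u` on pairs of points of the same fibre is smooth along the fibres if it is smooth
in all slice charts, jointly in both arguments. -/
def FiberSmooth (O : Set N) (u : N → N → V) : Prop :=
  ∀ g ∈ O, ∀ i, ∀ a ∈ (A.Φ i).chart.source, Γ.proj a = Γ.proj g →
    ContMDiffAt ((𝓡 n).prod (𝓡 k)) 𝓘(ℝ, V) ∞
      (fun p : N × Model k => u p.1 ((A.Φ i).chart.symm (Γ.proj p.1, p.2))) (g, ((A.Φ i).chart a).2)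

variable {A} in
theorem FiberSmooth.continuousOn [T2Space M] {O : Set N} {u : N → N → V} (hu : A.FiberSmooth O u)
    {g : N} (hg : g ∈ O) : ContinuousOn (u g) (Γ.proj ⁻¹' {Γ.proj g}) := by
  intro a ha
  obtain ⟨i, hi⟩ := A.χ.exists_pos_of_mem (Set.mem_univ a)
  have hs := A.mem_source_of_ne hi.ne'
  have h1 : ContinuousAt (fun b => (g, ((A.Φ i).chart b).2)) a :=
    continuousAt_const.prodMk ((A.Φ i).contMDiffAt_snd hs).continuousAt
  have h2 := ContinuousAt.comp
    (g := fun p : N × Model k => u p.1 ((A.Φ i).chart.symm (Γ.proj p.1, p.2)))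
    (f := fun b => (g, ((A.Φ i).chart b).2)) (hu g hg i a hs ha).continuousAt h1
  refine h2.continuousWithinAt.congr_of_eventuallyEq ?_ ?_
  · filter_upwards [mem_nhdsWithin_of_mem_nhds ((A.Φ i).chart.open_source.mem_nhds hs),
      self_mem_nhdsWithin] with b hb hb'
    have h3 := (A.Φ i).symm_snd hb
    rw [show Γ.proj b = Γ.proj g from hb'] at h3
    simp only [Function.comp_apply, h3]
  · have h3 := (A.Φ i).symm_snd hs
    rw [show Γ.proj a = Γ.proj g from ha] at h3
    simp only [Function.comp_apply, h3]

variable [IsManifold (𝓡 d) ∞ M] [IsManifold (𝓡 n) ∞ N]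

theorem continuousOn_density (i : A.ι) :
    ContinuousOn (A.density i) (A.Φ i).chart.source :=
  fun _ hg => (A.contMDiffAt_density hg).continuousAt.continuousWithinAt

theorem integrableOn_weight [T2Space M] (i : A.ι) (x : M) {u : N → V}
    (hu : ContinuousOn u (Γ.proj ⁻¹' {x})) :
    IntegrableOn (fun y => (A.χ i ((A.Φ i).chart.symm (x, y)) *
      A.density i ((A.Φ i).chart.symm (x, y))) • u ((A.Φ i).chart.symm (x, y)))
      ((A.Φ i).slice x) := by
  refine A.integrableOn_slice i x (w := fun g => (A.χ i g * A.density i g) • u g) ?_ ?_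
  · exact (((A.χ i).contMDiff.continuous.continuousOn).mul
      ((A.continuousOn_density i).mono Set.inter_subset_right)).smul (hu.mono Set.inter_subset_left)
  · intro g _ hg
    rw [image_eq_zero_of_notMem_tsupport hg, zero_mul, zero_smul]

/-- Averaging commutes with every linear operation on jets over one fibre: the projection to the
base, chart coordinates, and the product at a fixed pair. -/
theorem fiberIntegral_clm [T2Space M] [CompleteSpace V] {V' : Type*} [NormedAddCommGroup V']
    [NormedSpace ℝ V'] [CompleteSpace V'] (L : V →L[ℝ] V') {x : M} {u : N → V}
    (hu : ContinuousOn u (Γ.proj ⁻¹' {x})) :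
    A.fiberIntegral x (fun g => L (u g)) = L (A.fiberIntegral x u) := by
  obtain ⟨I, hI⟩ := A.exists_finset x
  rw [fiberIntegral_eq_sum hI.self_of_nhds, fiberIntegral_eq_sum hI.self_of_nhds, map_sum]
  refine Finset.sum_congr rfl fun i _ => ?_
  rw [← L.integral_comp_comm (A.integrableOn_weight i x hu)]
  simp only [map_smul]

/-- Some `χ i` is positive at `g`, hence on a nonempty open part of the slice, where the weight is
positive. This permits normalization. -/
theorem fiberIntegral_const_pos [T2Space M] (g : N) :
    0 < A.fiberIntegral (Γ.proj g) (fun _ => (1 : ℝ)) := by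
  obtain ⟨I, hI⟩ := A.exists_finset (Γ.proj g)
  have hint := fun i => A.integrableOn_weight i (Γ.proj g) (u := fun _ => (1 : ℝ))
    continuousOn_const
  rw [fiberIntegral_eq_sum hI.self_of_nhds]
  have hnn : ∀ i, ∀ y ∈ (A.Φ i).slice (Γ.proj g), 0 ≤
      (A.χ i ((A.Φ i).chart.symm (Γ.proj g, y)) *
        A.density i ((A.Φ i).chart.symm (Γ.proj g, y))) • (1 : ℝ) := fun i y hy => by
    rw [smul_eq_mul, mul_one]
    exact mul_nonneg (A.χ.nonneg _ _) (A.density_pos ((A.Φ i).chart.map_target hy)).le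
  obtain ⟨i, hi⟩ := A.χ.exists_pos_of_mem (Set.mem_univ g)
  have hiI : i ∈ I := by
    by_contra h
    exact hi.ne' (hI.self_of_nhds g rfl i h)
  refine Finset.sum_pos' (fun i _ => setIntegral_nonneg
    ((A.Φ i).isOpen_slice _).measurableSet (hnn i)) ⟨i, hiI, ?_⟩
  rw [setIntegral_pos_iff_support_of_nonneg_ae
    ((ae_restrict_mem ((A.Φ i).isOpen_slice _).measurableSet).mono (hnn i)) (hint i)]
  have hgs := A.mem_source_of_ne hi.ne'
  have hopen : IsOpen ((A.Φ i).slice (Γ.proj g) ∩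
      {y | 0 < A.χ i ((A.Φ i).chart.symm (Γ.proj g, y))}) := by
    have hc : ContinuousOn (fun y => A.χ i ((A.Φ i).chart.symm (Γ.proj g, y)))
        ((A.Φ i).slice (Γ.proj g)) :=
      (A.χ i).contMDiff.continuous.comp_continuousOn ((A.Φ i).chart.continuousOn_symm.comp
        (Continuous.prodMk_right _).continuousOn fun y hy => hy)
    exact hc.isOpen_inter_preimage ((A.Φ i).isOpen_slice _) isOpen_Ioi
  refine (hopen.measure_pos volume ⟨((A.Φ i).chart g).2, (A.Φ i).mem_target hgs, ?_⟩).trans_le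
    (measure_mono ?_)
  · rw [Set.mem_ofPred_eq, (A.Φ i).symm_snd hgs]
    exact hi
  · rintro y ⟨hy, hy'⟩
    refine ⟨?_, hy⟩
    rw [Function.mem_support, smul_eq_mul, mul_one]
    exact (mul_pos hy' (A.density_pos ((A.Φ i).chart.map_target hy))).ne'

end SlicePartition

end SmoothGroupBundle

/-! ### Left invariance and smooth dependence of the fibre integral. -/

namespace SmoothGroupBundle

open MeasureTheory

variable {d n k : ℕ} {M : Type u} [TopologicalSpace M] [ChartedSpace (Model d) M]
  {N : Type v} [TopologicalSpace N] [ChartedSpace (Model n) N]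
  {Γ : SmoothGroupBundle d n M N}

theorem image_translation (Φ₁ Φ₂ : SliceChart (d := d) (n := n) k Γ.proj) (h : N) :
    Γ.translation Φ₁ Φ₂ h '' Γ.translationDomain Φ₁ Φ₂ h =
      Γ.translationDomain Φ₂ Φ₁ (Γ.inv h) := by
  ext y
  constructor
  · rintro ⟨z, hz, rfl⟩
    exact translation_inv_mem hz
  · intro hy
    have h1 := translation_inv_mem hy
    have h2 := translation_inv_translation hy
    rw [Γ.inv_inv] at h1 h2
    exact ⟨_, h1, h2⟩

theorem continuousOn_mul_left (h : N) :
    ContinuousOn (Γ.mul h) (Γ.proj ⁻¹' {Γ.proj h}) := by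
  intro g hg
  obtain ⟨f, hf, hfm⟩ := Γ.smooth_mul (a := h) (b := g) hg.symm
  have hc : ContinuousAt (fun a : N => (h, a)) g := (Continuous.prodMk_right h).continuousAt
  have h1 : ContinuousAt (fun a => f (h, a)) g := ContinuousAt.comp (g := f) hf.continuousAt hc
  refine h1.continuousWithinAt.congr_of_eventuallyEq ?_ (hfm.self_of_nhds hg.symm).symm
  filter_upwards [mem_nhdsWithin_of_mem_nhds (hc.eventually hfm), self_mem_nhdsWithin] with a ha ha'
  exact (ha ha'.symm).symm

variable [IsManifold (𝓡 d) ∞ M] [IsManifold (𝓡 n) ∞ N]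

namespace SlicePartition

variable (A : Γ.SlicePartition k)
  {V : Type*} [NormedAddCommGroup V] [NormedSpace ℝ V]

/-- Substitution of `h g` for the variable, the Jacobian being absorbed by `density_mul`. The two
cutoffs exchange roles, and they make the integrands vanish where the translation leaves the other
chart. -/
theorem setIntegral_translation (i i' : A.ι) (h : N) (u : N → V) :
    ∫ y in (A.Φ i).slice (Γ.proj h),
      A.χ i' (Γ.mul h ((A.Φ i).chart.symm (Γ.proj h, y))) •
        (A.χ i ((A.Φ i).chart.symm (Γ.proj h, y)) *
          A.density i ((A.Φ i).chart.symm (Γ.proj h, y))) •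
            u (Γ.mul h ((A.Φ i).chart.symm (Γ.proj h, y))) =
    ∫ y in (A.Φ i').slice (Γ.proj h),
      A.χ i (Γ.mul (Γ.inv h) ((A.Φ i').chart.symm (Γ.proj h, y))) •
        (A.χ i' ((A.Φ i').chart.symm (Γ.proj h, y)) *
          A.density i' ((A.Φ i').chart.symm (Γ.proj h, y))) •
            u ((A.Φ i').chart.symm (Γ.proj h, y)) := by
  have h1 : Γ.translationDomain (A.Φ i) (A.Φ i') h ⊆ (A.Φ i).slice (Γ.proj h) :=
    fun y hy => hy.1
  have h2 : Γ.translationDomain (A.Φ i') (A.Φ i) (Γ.inv h) ⊆ (A.Φ i').slice (Γ.proj h) :=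
    fun y hy => Γ.proj_inv h ▸ hy.1
  rw [setIntegral_eq_of_subset_of_forall_sdiff_eq_zero
      ((A.Φ i).isOpen_slice _).measurableSet h1,
    setIntegral_eq_of_subset_of_forall_sdiff_eq_zero
      ((A.Φ i').isOpen_slice _).measurableSet h2, ← image_translation (A.Φ i) (A.Φ i'),
    integral_image_eq_integral_abs_det_fderiv_smul volume
      (isOpen_translationDomain (Γ := Γ) h).measurableSet
      (fun y hy => (differentiableAt_translation hy).hasFDerivAt.hasFDerivWithinAt)]
  · refine setIntegral_congr_fun (isOpen_translationDomain (Γ := Γ) h).measurableSet fun y hy => ?_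
    have h3 := (A.Φ i).proj_symm hy.1
    have h4 := A.density_mul h3.symm ((A.Φ i).chart.map_target hy.1) hy.2
    rw [(A.Φ i).chart_symm_snd hy.1] at h4
    simp only [symm_translation hy, Γ.inv_mul_cancel_left h3.symm]
    rw [h4]
    simp only [smul_smul]
    congr 1
    ring
  · intro y hy z hz hyz
    rw [← translation_inv_translation hy, hyz, translation_inv_translation hz]
  · rintro y ⟨hy, hy'⟩
    have h3 : A.χ i (Γ.mul (Γ.inv h) ((A.Φ i').chart.symm (Γ.proj h, y))) = 0 := by
      by_contra h0
      refine hy' ⟨by rw [Γ.proj_inv]; exact hy, ?_⟩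
      rw [Γ.proj_inv]
      exact A.mem_source_of_ne h0
    rw [h3, zero_smul]
  · rintro y ⟨hy, hy'⟩
    have h3 : A.χ i' (Γ.mul h ((A.Φ i).chart.symm (Γ.proj h, y))) = 0 := by
      by_contra h0
      exact hy' ⟨hy, A.mem_source_of_ne h0⟩
    rw [h3, zero_smul]

/-- The identities `∑ j, χ j (h g) = 1` and `∑ j, χ j (h⁻¹ g) = 1`, inserted on the two sides, cut
both integrals into pieces that `setIntegral_translation` matches in pairs. -/
theorem fiberIntegral_mul_left [T2Space M] (h : N) {u : N → V}
    (hu : ContinuousOn u (Γ.proj ⁻¹' {Γ.proj h})) :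
    A.fiberIntegral (Γ.proj h) (fun g => u (Γ.mul h g)) = A.fiberIntegral (Γ.proj h) u := by
  obtain ⟨I, hI'⟩ := A.exists_finset (Γ.proj h)
  have hI := hI'.self_of_nhds
  rw [fiberIntegral_eq_sum hI, fiberIntegral_eq_sum hI]
  have hmul : ∀ h' : N, Γ.proj h' = Γ.proj h → ContinuousOn (Γ.mul h') (Γ.proj ⁻¹' {Γ.proj h}) :=
    fun h' hh => hh ▸ continuousOn_mul_left h'
  have hmaps : ∀ h' : N, Γ.proj h' = Γ.proj h →
      Set.MapsTo (Γ.mul h') (Γ.proj ⁻¹' {Γ.proj h}) (Γ.proj ⁻¹' {Γ.proj h}) := by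
    intro h' hh g hg
    rw [Set.mem_preimage, Γ.proj_mul (hh.trans hg.symm)]
    exact hg
  have key : ∀ (h' : N) (_ : Γ.proj h' = Γ.proj h) (i : A.ι) {f : N → V}
      (_ : ContinuousOn f (Γ.proj ⁻¹' {Γ.proj h})),
      ∫ y in (A.Φ i).slice (Γ.proj h), (A.χ i ((A.Φ i).chart.symm (Γ.proj h, y)) *
        A.density i ((A.Φ i).chart.symm (Γ.proj h, y))) • f ((A.Φ i).chart.symm (Γ.proj h, y)) =
      ∑ j ∈ I, ∫ y in (A.Φ i).slice (Γ.proj h),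
        A.χ j (Γ.mul h' ((A.Φ i).chart.symm (Γ.proj h, y))) •
        (A.χ i ((A.Φ i).chart.symm (Γ.proj h, y)) *
        A.density i ((A.Φ i).chart.symm (Γ.proj h, y))) •
          f ((A.Φ i).chart.symm (Γ.proj h, y)) := by
    intro h' hh i f hf
    rw [← integral_finsetSum]
    · refine setIntegral_congr_fun ((A.Φ i).isOpen_slice _).measurableSet fun y hy => ?_
      have h3 := (A.Φ i).proj_symm hy
      rw [← Finset.sum_smul, A.sum_eq_one, one_smul]
      exact hI _ ((Γ.proj_mul (hh.trans h3.symm)).trans h3)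
    · intro j _
      have := A.integrableOn_weight i (Γ.proj h) (u := fun g => A.χ j (Γ.mul h' g) • f g)
        (((A.χ j).contMDiff.continuous.comp_continuousOn (hmul h' hh)).smul hf)
      simp only [smul_comm (A.χ j _)]
      exact this
  rw [Finset.sum_congr rfl fun i _ => key h rfl i (f := fun g => u (Γ.mul h g))
    (hu.comp (hmul h rfl) (hmaps h rfl)),
    Finset.sum_congr rfl fun i _ => key (Γ.inv h) (Γ.proj_inv h) i hu, Finset.sum_comm]
  refine Finset.sum_congr rfl fun i' _ => Finset.sum_congr rfl fun i _ => ?_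
  exact A.setIntegral_translation i i' h u

variable {A}

theorem FiberSmooth.contMDiffAt_fiberIntegral [T2Space M] {O : Set N} (hO : IsOpen O)
    {u : N → N → V} (hu : A.FiberSmooth O u) {g₀ : N} (hg₀ : g₀ ∈ O) :
    ContMDiffAt (𝓡 n) 𝓘(ℝ, V) ∞ (fun g => A.fiberIntegral (Γ.proj g) (u g)) g₀ := by
  obtain ⟨I, hI⟩ := A.exists_finset (Γ.proj g₀)
  have hproj : Continuous Γ.proj := Γ.contMDiff_proj.continuous
  have hterm : ∀ i ∈ I, ContMDiffAt (𝓡 n) 𝓘(ℝ, V) ∞ (fun g => ∫ y in (A.Φ i).slice (Γ.proj g),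
      (A.χ i ((A.Φ i).chart.symm (Γ.proj g, y)) * A.density i ((A.Φ i).chart.symm (Γ.proj g, y))) •
        u g ((A.Φ i).chart.symm (Γ.proj g, y))) g₀ := by
    intro i _
    have : LocallyCompactSpace M := ChartedSpace.locallyCompactSpace (Model d) M
    obtain ⟨K, hK, hxK⟩ := exists_compact_mem_nhds (Γ.proj g₀)
    let S : Set N := Γ.proj ⁻¹' K ∩ tsupport (A.χ i)
    have hS : IsCompact S := (Γ.isCompact_preimage K hK).inter_right (isClosed_tsupport _)
    have hCt : IsCompact ((A.Φ i).chart '' S) :=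
      hS.image_of_continuousOn ((A.Φ i).chart.continuousOn.mono fun g hg => A.mem_source hg.2)
    simp only [← integral_indicator ((A.Φ i).isOpen_slice _).measurableSet]
    -- The integrand vanishes off the compact set `chart '' S` inside the chart target, so its
    -- extension by zero stays smooth across the boundary of the slices.
    have hout : ∀ (g : N) (y : Model k), Γ.proj g ∈ K → (Γ.proj g, y) ∉ (A.Φ i).chart '' S →
        ((A.Φ i).slice (Γ.proj g)).indicator (fun y => (A.χ i ((A.Φ i).chart.symm (Γ.proj g, y)) *
          A.density i ((A.Φ i).chart.symm (Γ.proj g, y))) •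
            u g ((A.Φ i).chart.symm (Γ.proj g, y))) y = 0 := by
      intro g y hgK hgy
      by_cases hy : y ∈ (A.Φ i).slice (Γ.proj g)
      · have h0 : (A.Φ i).chart.symm (Γ.proj g, y) ∉ tsupport (A.χ i) := fun h0 =>
          hgy ⟨_, ⟨by rwa [Set.mem_preimage, (A.Φ i).proj_symm hy], h0⟩,
            (A.Φ i).chart.right_inv hy⟩
        rw [Set.indicator_of_mem hy, image_eq_zero_of_notMem_tsupport h0, zero_mul, zero_smul]
      · exact Set.indicator_of_notMem hy _
    refine contMDiffAt_parametric_integral (O := O ∩ Γ.proj ⁻¹' interior K)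
      (hO.inter (isOpen_interior.preimage hproj)) ⟨hg₀, mem_interior_iff_mem_nhds.2 hxK⟩
      (hCt.image continuous_snd) ?_ ?_
    · rintro g ⟨-, hgK⟩ y hy
      exact hout g y (interior_subset hgK) fun h0 => hy ⟨_, h0, rfl⟩
    · rintro g ⟨hgO, hgK⟩ y
      by_cases hy : (Γ.proj g, y) ∈ (A.Φ i).chart.target
      · have h1 := contMDiffAt_symm_proj (Φ := A.Φ i) hy
        have hs := (A.Φ i).chart.map_target hy
        have h2 : ContMDiffAt ((𝓡 n).prod (𝓡 k)) 𝓘(ℝ) ∞ (fun p : N × Model k =>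
            A.χ i ((A.Φ i).chart.symm (Γ.proj p.1, p.2))) (g, y) :=
          ContMDiffAt.comp (g, y) (g := A.χ i) ((A.χ i).contMDiff _) h1
        have h3 : ContMDiffAt ((𝓡 n).prod (𝓡 k)) 𝓘(ℝ) ∞ (fun p : N × Model k =>
            A.density i ((A.Φ i).chart.symm (Γ.proj p.1, p.2))) (g, y) :=
          ContMDiffAt.comp (g, y) (g := A.density i) (A.contMDiffAt_density hs) h1
        have h4 := hu g hgO i _ hs ((A.Φ i).proj_symm hy)
        rw [(A.Φ i).chart_symm_snd hy] at h4
        refine ((h2.mul h3).smul h4).congr_of_eventuallyEq ?_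
        filter_upwards [eventually_symm_proj (Φ := A.Φ i) hy] with p hp
        exact Set.indicator_of_mem (s := (A.Φ i).slice (Γ.proj p.1)) hp _
      · refine (contMDiffAt_const (c := (0 : V))).congr_of_eventuallyEq ?_
        have h1 : (Γ.proj g, y) ∉ (A.Φ i).chart '' S := by
          rintro ⟨a, ha, hay⟩
          exact hy (hay ▸ (A.Φ i).chart.map_source (A.mem_source ha.2))
        have h2 : Continuous (fun p : N × Model k => (Γ.proj p.1, p.2)) :=
          (hproj.comp continuous_fst).prodMk continuous_snd
        filter_upwards [h2.continuousAt.eventually (hCt.isClosed.isOpen_compl.mem_nhds h1),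
          (hproj.comp continuous_fst).continuousAt.eventually (isOpen_interior.mem_nhds hgK)]
          with p hp hp'
        exact hout _ _ (interior_subset hp') hp
  refine (contMDiffAt_finsetSum hterm).congr_of_eventuallyEq ?_
  filter_upwards [hproj.continuousAt.eventually hI] with g hg
  exact fiberIntegral_eq_sum hg _

end SlicePartition

end SmoothGroupBundle

/-! ### Derivatives of maps between manifolds, with values in the model spaces -/

section MDeriv

variable {E : Type*} [NormedAddCommGroup E] [NormedSpace ℝ E] {H : Type*} [TopologicalSpace H]
  {I : ModelWithCorners ℝ E H} {M : Type*} [TopologicalSpace M] [ChartedSpace H M]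
  {E' : Type*} [NormedAddCommGroup E'] [NormedSpace ℝ E'] {H' : Type*} [TopologicalSpace H']
  {I' : ModelWithCorners ℝ E' H'} {M' : Type*} [TopologicalSpace M'] [ChartedSpace H' M']
  {E'' : Type*} [NormedAddCommGroup E''] [NormedSpace ℝ E''] {H'' : Type*} [TopologicalSpace H'']
  {I'' : ModelWithCorners ℝ E'' H''} {M'' : Type*} [TopologicalSpace M''] [ChartedSpace H'' M'']

variable (I I') in
/-- The manifold derivative, as a map between the model vector spaces. -/
def mderiv (f : M → M') (x : M) : E →L[ℝ] E' := mfderiv I I' f x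

theorem mderiv_congr {f g : M → M'} {x : M} (h : f =ᶠ[𝓝 x] g) :
    mderiv I I' f x = mderiv I I' g x :=
  h.mfderiv_eq

theorem mderiv_comp {g : M' → M''} {f : M → M'} {x : M} {y : M'} (hy : f x = y)
    (hg : ContMDiffAt I' I'' ∞ g y) (hf : ContMDiffAt I I' ∞ f x) :
    mderiv I I'' (fun z => g (f z)) x = (mderiv I' I'' g y).comp (mderiv I I' f x) := by
  subst hy
  exact mfderiv_comp x (hg.mdifferentiableAt (by simp)) (hf.mdifferentiableAt (by simp))

theorem mderiv_prodMk {f : M → M'} {g : M → M''} {x : M} (hf : ContMDiffAt I I' ∞ f x)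
    (hg : ContMDiffAt I I'' ∞ g x) :
    mderiv I (I'.prod I'') (fun z => (f z, g z)) x = (mderiv I I' f x).prod (mderiv I I'' g x) :=
  mfderiv_prodMk (hf.mdifferentiableAt (by simp)) (hg.mdifferentiableAt (by simp))

theorem mderiv_id (x : M) : mderiv I I (fun z => z) x = ContinuousLinearMap.id ℝ E :=
  mfderiv_id

end MDeriv

theorem dimension_eq_of_local_inverse {m n : ℕ} {N : Type*} [TopologicalSpace N]
    [ChartedSpace (Model n) N] {N' : Type*} [TopologicalSpace N'] [ChartedSpace (Model m) N']
    {F : N → N'} {F' : N' → N}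
    {e : N} {g : N'} (hF : ContMDiffAt (𝓡 n) (𝓡 m) ∞ F e) (hF' : ContMDiffAt (𝓡 m) (𝓡 n) ∞ F' g)
    (he : F e = g) (hg : F' g = e) (h : ∀ᶠ k in 𝓝 e, F' (F k) = k)
    (h' : ∀ᶠ k in 𝓝 g, F (F' k) = k) : n = m := by
  have h1 : (mderiv (𝓡 m) (𝓡 n) F' g).comp (mderiv (𝓡 n) (𝓡 m) F e) =
      ContinuousLinearMap.id ℝ (Model n) := by
    rw [← mderiv_comp he hF' hF, mderiv_congr h, mderiv_id]
  have h2 : (mderiv (𝓡 n) (𝓡 m) F e).comp (mderiv (𝓡 m) (𝓡 n) F' g) =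
      ContinuousLinearMap.id ℝ (Model m) := by
    rw [← mderiv_comp hg hF hF', mderiv_congr h', mderiv_id]
  have h3 := (ContinuousLinearEquiv.equivOfInverse' _ _ h2 h1).toLinearEquiv.finrank_eq
  rwa [finrank_euclideanSpace_fin, finrank_euclideanSpace_fin] at h3

/-- The derivative, in fixed charts around `x₀` and `g₀`, of a map depending smoothly on a
parameter depends smoothly on the parameter. -/
theorem contMDiffAt_mderiv_inCoordinates {d n : ℕ} {M : Type*} [TopologicalSpace M]
    [ChartedSpace (Model d) M] [IsManifold (𝓡 d) ∞ M] {N : Type*} [TopologicalSpace N]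
    [ChartedSpace (Model n) N] [IsManifold (𝓡 n) ∞ N]
    {E' : Type*} [NormedAddCommGroup E'] [NormedSpace ℝ E'] {H' : Type*} [TopologicalSpace H']
    {J : ModelWithCorners ℝ E' H'} {P : Type*} [TopologicalSpace P] [ChartedSpace H' P]
    [IsManifold J ∞ P]
    {S : P → M → N} {b : P → M} {p₁ : P} {x₀ : M} {g₀ : N}
    (hS : ContMDiffAt (J.prod (𝓡 d)) (𝓡 n) ∞ (Function.uncurry S) (p₁, b p₁))
    (hb : ContMDiffAt J (𝓡 d) ∞ b p₁) (hx : b p₁ ∈ (chartAt (Model d) x₀).source)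
    (hg : S p₁ (b p₁) ∈ (chartAt (Model n) g₀).source) :
    ContMDiffAt J 𝓘(ℝ, Model d →L[ℝ] Model n) ∞ (fun p =>
      (mderiv (𝓡 n) (𝓡 n) (extChartAt (𝓡 n) g₀) (S p (b p))).comp
        ((mderiv (𝓡 d) (𝓡 n) (S p) (b p)).comp
          (mderiv (𝓡 d) (𝓡 d) (extChartAt (𝓡 d) x₀).symm (extChartAt (𝓡 d) x₀ (b p))))) p₁ := by
  let e := extChartAt (𝓡 d) x₀
  let e' := extChartAt (𝓡 n) g₀
  have hes : ∀ x ∈ (chartAt (Model d) x₀).source, e.symm (e x) = x := fun x hx =>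
    e.left_inv (by rwa [extChartAt_source])
  have hesm : ∀ x ∈ (chartAt (Model d) x₀).source, ContMDiffAt (𝓡 d) (𝓡 d) ∞ e.symm (e x) :=
    fun x hx => (contMDiffOn_extChartAt_symm x₀).contMDiffAt ((isOpen_extChartAt_target x₀).mem_nhds
      (e.map_source (by rwa [extChartAt_source])))
  have he' : ∀ a ∈ (chartAt (Model n) g₀).source, ContMDiffAt (𝓡 n) (𝓡 n) ∞ e' a :=
    fun a ha => contMDiffAt_extChartAt' ha
  have heb : ContMDiffAt J (𝓡 d) ∞ (fun p => e (b p)) p₁ :=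
    ContMDiffAt.comp p₁ (g := e) (contMDiffAt_extChartAt' hx) hb
  have hSe : ContMDiffAt (J.prod (𝓡 d)) (𝓡 n) ∞ (fun q : P × Model d => S q.1 (e.symm q.2))
      (p₁, e (b p₁)) := by
    refine ContMDiffAt.comp_of_eq (g := Function.uncurry S)
      (f := fun q : P × Model d => (q.1, e.symm q.2)) hS
      (contMDiffAt_fst.prodMk ?_) (by simp only [hes _ hx])
    exact ContMDiffAt.comp (p₁, e (b p₁)) (g := e.symm) (f := Prod.snd) (hesm _ hx) contMDiffAt_snd
  have hf : ContMDiffAt (J.prod (𝓡 d)) (𝓡 n) ∞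
      (Function.uncurry fun (p : P) (q : Model d) => e' (S p (e.symm q))) (p₁, e (b p₁)) :=
    ContMDiffAt.comp_of_eq (g := e') (f := fun q : P × Model d => S q.1 (e.symm q.2)) (he' _ hg)
      hSe (by simp only [hes _ hx])
  have key := ContMDiffAt.mfderiv (fun (p : P) (q : Model d) => e' (S p (e.symm q)))
    (fun p => e (b p)) (m := ∞) hf heb (by simp)
  -- The chain rule is needed at all `p` near `p₁`. Being of class `C¹` at a point passes to a
  -- neighbourhood, and order one suffices for it.
  have hS1 : ∀ᶠ p in 𝓝 p₁, MDifferentiableAt (𝓡 d) (𝓡 n) (S p) (b p) := by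
    have h1 := (contMDiffAt_iff_contMDiffAt_nhds (n := 1) (by simp)).1
      (hS.of_le (by exact_mod_cast le_top))
    have h2 : ContinuousAt (fun p => (p, b p)) p₁ := continuousAt_id.prodMk hb.continuousAt
    filter_upwards [h2.eventually h1] with p hp
    have h3 : ContMDiffAt (𝓡 d) (𝓡 n) 1 (S p) (b p) :=
      ContMDiffAt.comp (b p) (g := Function.uncurry S) (f := fun x => (p, x)) hp
        (contMDiffAt_const.prodMk contMDiffAt_id)
    exact h3.mdifferentiableAt one_ne_zero
  have hSb : ContinuousAt (fun p => S p (b p)) p₁ :=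
    ContinuousAt.comp (g := Function.uncurry S) (f := fun p => (p, b p)) hS.continuousAt
      (continuousAt_id.prodMk hb.continuousAt)
  refine key.congr_of_eventuallyEq ?_
  filter_upwards [hS1, hb.continuousAt.eventually ((chartAt (Model d) x₀).open_source.mem_nhds hx),
    hSb.eventually ((chartAt (Model n) g₀).open_source.mem_nhds hg)] with p hp1 hp2 hp3
  refine Eq.trans ?_ (congrFun (inTangentCoordinates_model_space (I := 𝓡 d) (I' := 𝓡 n)
    (fun p => e (b p)) (fun p => e' (S p (e.symm (e (b p)))))
    (fun p => mfderiv (𝓡 d) (𝓡 n) (fun q : Model d => e' (S p (e.symm q))) (e (b p))) p₁) p).symm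
  have h1 : MDifferentiableAt (𝓡 d) (𝓡 d) e.symm (e (b p)) :=
    (hesm _ hp2).mdifferentiableAt (by simp)
  have h2 : MDifferentiableAt (𝓡 n) (𝓡 n) e' (S p (b p)) :=
    (he' _ hp3).mdifferentiableAt (by simp)
  have h3 : MDifferentiableAt (𝓡 d) (𝓡 n) (fun q => S p (e.symm q)) (e (b p)) :=
    MDifferentiableAt.comp_of_eq (e (b p)) (g := S p) (f := e.symm) hp1 h1 (hes _ hp2)
  have h4 := mfderiv_comp_of_eq (x := e (b p)) (g := e') (f := fun q => S p (e.symm q)) h2 h3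
    (by simp only [hes _ hp2])
  have h5 := mfderiv_comp_of_eq (x := e (b p)) (g := S p) (f := e.symm) hp1 h1 (hes _ hp2)
  have h6 : mderiv (𝓡 d) (𝓡 n) (fun q => e' (S p (e.symm q))) (e (b p)) =
      (mderiv (𝓡 n) (𝓡 n) e' (S p (e.symm (e (b p))))).comp
        ((mderiv (𝓡 d) (𝓡 n) (S p) (e.symm (e (b p)))).comp
          (mderiv (𝓡 d) (𝓡 d) e.symm (e (b p)))) :=
    h4.trans (congrArg (fun B => (mderiv (𝓡 n) (𝓡 n) e' (S p (e.symm (e (b p))))).comp B) h5)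
  rw [hes _ hp2] at h6
  exact h6.symm

namespace SmoothGroupBundle

variable {d n k : ℕ} {M : Type u} [TopologicalSpace M] [ChartedSpace (Model d) M]
  {N : Type v} [TopologicalSpace N] [ChartedSpace (Model n) N]
  (Γ : SmoothGroupBundle d n M N)

/-! ### Local sections and their jets -/

/-- `σ` is a smooth local section of the bundle near `x`. -/
structure IsSectionAt (σ : M → N) (x : M) : Prop where
  smooth : ContMDiffAt (𝓡 d) (𝓡 n) ∞ σ x
  proj_eq : ∀ᶠ y in 𝓝 x, Γ.proj (σ y) = y

/-- The first jet of a local section, that is, its derivative. -/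
abbrev jet (_Γ : SmoothGroupBundle d n M N) (σ : M → N) (x : M) : Model d →L[ℝ] Model n :=
  mderiv (𝓡 d) (𝓡 n) σ x

variable {Γ}

namespace IsSectionAt

variable {σ τ : M → N} {x : M}

theorem proj_apply (h : Γ.IsSectionAt σ x) : Γ.proj (σ x) = x := h.proj_eq.self_of_nhds

theorem proj_eq_proj (hσ : Γ.IsSectionAt σ x) (hτ : Γ.IsSectionAt τ x) :
    ∀ᶠ y in 𝓝 x, Γ.proj (σ y) = Γ.proj (τ y) := by
  filter_upwards [hσ.proj_eq, hτ.proj_eq] with y h1 h2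
  rw [h1, h2]

theorem mul (hσ : Γ.IsSectionAt σ x) (hτ : Γ.IsSectionAt τ x) :
    Γ.IsSectionAt (fun y => Γ.mul (σ y) (τ y)) x := by
  refine ⟨Γ.contMDiffAt_mul hσ.smooth hτ.smooth (hσ.proj_eq_proj hτ), ?_⟩
  filter_upwards [hσ.proj_eq, hτ.proj_eq] with y h1 h2
  rw [Γ.proj_mul (h1.trans h2.symm), h2]

theorem inv (hσ : Γ.IsSectionAt σ x) : Γ.IsSectionAt (fun y => Γ.inv (σ y)) x := by
  refine ⟨Γ.contMDiffAt_inv hσ.smooth, ?_⟩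
  filter_upwards [hσ.proj_eq] with y h1
  rw [Γ.proj_inv, h1]

theorem one (hσ : Γ.IsSectionAt σ x) : Γ.IsSectionAt Γ.one x := by
  refine ⟨hσ.proj_apply ▸ Γ.smooth_one (σ x), ?_⟩
  filter_upwards [hσ.proj_eq] with y h1
  rw [← h1, Γ.proj_one]

variable [IsManifold (𝓡 d) ∞ M] [IsManifold (𝓡 n) ∞ N]

theorem mderiv_proj_comp_jet (hσ : Γ.IsSectionAt σ x) {g : N} (hg : σ x = g) :
    (mderiv (𝓡 n) (𝓡 d) Γ.proj g).comp (Γ.jet σ x) = ContinuousLinearMap.id ℝ (Model d) := by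
  rw [← mderiv_comp hg (Γ.contMDiff_proj g) hσ.smooth, mderiv_congr hσ.proj_eq, mderiv_id]

end IsSectionAt

/-- Two local sections form composable pairs near `x`, so any extension `f` agrees with the
multiplication along them. Hence jets of products do not depend on the extension, which also serves
the tangent groupoid. -/
theorem jet_mul_eq {f : N × N → N} {a b : N} (hf : ContMDiffAt ((𝓡 n).prod (𝓡 n)) (𝓡 n) ∞ f (a, b))
    (hfm : ∀ᶠ p in 𝓝 (a, b), Γ.proj p.1 = Γ.proj p.2 → f p = Γ.mul p.1 p.2) {σ τ : M → N} {x : M}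
    (hσ : Γ.IsSectionAt σ x) (hτ : Γ.IsSectionAt τ x) (ha : σ x = a) (hb : τ x = b) :
    Γ.jet (fun y => Γ.mul (σ y) (τ y)) x =
      (mderiv ((𝓡 n).prod (𝓡 n)) (𝓡 n) f (a, b)).comp ((Γ.jet σ x).prod (Γ.jet τ x)) := by
  have hc : ContinuousAt (fun y => (σ y, τ y)) x :=
    hσ.smooth.continuousAt.prodMk hτ.smooth.continuousAt
  have hev : (fun y => Γ.mul (σ y) (τ y)) =ᶠ[𝓝 x] fun y => f (σ y, τ y) := by
    have hfm' : ∀ᶠ p in 𝓝 (σ x, τ x), Γ.proj p.1 = Γ.proj p.2 → f p = Γ.mul p.1 p.2 := by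
      rwa [ha, hb]
    filter_upwards [hσ.proj_eq_proj hτ, hc.eventually hfm'] with y h1 h2
    exact (h2 h1).symm
  rw [jet, mderiv_congr hev, mderiv_comp (f := fun y => (σ y, τ y)) (Prod.ext ha hb) hf
    (hσ.smooth.prodMk hτ.smooth), mderiv_prodMk hσ.smooth hτ.smooth]

/-- What matters is the order of the quantifiers: one linear map `B` serves all sections through `a`
and `b`, so averages of jets can be taken through it. -/
theorem exists_mulDeriv {a b : N} (h : Γ.proj a = Γ.proj b) :
    ∃ B : (Model n × Model n) →L[ℝ] Model n, ∀ {σ τ : M → N} {x : M}, Γ.IsSectionAt σ x →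
      Γ.IsSectionAt τ x → σ x = a → τ x = b →
        Γ.jet (fun y => Γ.mul (σ y) (τ y)) x = B.comp ((Γ.jet σ x).prod (Γ.jet τ x)) := by
  obtain ⟨f, hf, hfm⟩ := Γ.smooth_mul h
  exact ⟨_, fun hσ hτ ha hb => jet_mul_eq hf hfm hσ hτ ha hb⟩

theorem jet_inv_eq {σ : M → N} {x : M} (hσ : Γ.IsSectionAt σ x) {a : N} (ha : σ x = a) :
    Γ.jet (fun y => Γ.inv (σ y)) x = (mderiv (𝓡 n) (𝓡 n) Γ.inv a).comp (Γ.jet σ x) :=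
  mderiv_comp ha (Γ.smooth_inv a) hσ.smooth

theorem exists_divDeriv {a b : N} (h : Γ.proj a = Γ.proj b) :
    ∃ B : (Model n × Model n) →L[ℝ] Model n, ∀ {σ τ : M → N} {x : M}, Γ.IsSectionAt σ x →
      Γ.IsSectionAt τ x → σ x = a → τ x = b →
        Γ.jet (fun y => Γ.mul (σ y) (Γ.inv (τ y))) x = B.comp ((Γ.jet σ x).prod (Γ.jet τ x)) := by
  obtain ⟨B, hB⟩ := exists_mulDeriv (h.trans (Γ.proj_inv b).symm)
  refine ⟨B.comp ((ContinuousLinearMap.id ℝ (Model n)).prodMap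
    (mderiv (𝓡 n) (𝓡 n) Γ.inv b)), fun hσ hτ ha hb => ?_⟩
  rw [hB hσ hτ.inv ha (congrArg Γ.inv hb), jet_inv_eq hτ hb]
  rfl

section Realization

variable [IsManifold (𝓡 d) ∞ M] [IsManifold (𝓡 n) ∞ N]

/-- Every right inverse of the derivative of the projection is the jet of a local section. -/
theorem exists_isSectionAt (g : N) {L : Model d →L[ℝ] Model n}
    (hL : (mderiv (𝓡 n) (𝓡 d) Γ.proj g).comp L = ContinuousLinearMap.id ℝ (Model d)) :
    ∃ σ, Γ.IsSectionAt σ (Γ.proj g) ∧ σ (Γ.proj g) = g ∧ Γ.jet σ (Γ.proj g) = L := by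
  obtain ⟨Φ, hΦ⟩ := exists_sliceChart (Γ.submersion.isSubmersionAt g)
  let x := Γ.proj g
  let e := extChartAt (𝓡 d) x
  -- The vertical component of `L` in the slice chart; its horizontal component is the identity by
  -- `hL`. The section is the graph of an affine map with slope `A`.
  let A : Model d →L[ℝ] Model (n - d) :=
    (mderiv (𝓡 n) (𝓡 (n - d)) (fun a => (Φ.chart a).2) g).comp L
  let f : M → Model (n - d) := fun y => A (e y - e x) + (Φ.chart g).2
  have hΨ : ContMDiffAt ((𝓡 d).prod (𝓡 (n - d))) (𝓡 n) ∞ Φ.chart.symm (x, (Φ.chart g).2) :=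
    Φ.contMDiffAt_symm (Φ.mem_target hΦ)
  have hfA : ContMDiff (𝓡 d) (𝓡 (n - d)) ∞ (fun z : Model d => A (z - e x) + (Φ.chart g).2) :=
    ((A.contDiff.comp (contDiff_id.sub contDiff_const)).add contDiff_const).contMDiff
  have hf : ContMDiffAt (𝓡 d) (𝓡 (n - d)) ∞ f x :=
    (hfA _).comp x (contMDiffAt_extChartAt (I := 𝓡 d))
  have hfx : f x = (Φ.chart g).2 := by simp [f]
  have hdf : mderiv (𝓡 d) (𝓡 (n - d)) f x = A := by
    rw [show f = fun y => (fun z : Model d => A (z - e x) + (Φ.chart g).2) (e y) from rfl,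
      mderiv_comp (f := e) rfl (hfA _) (contMDiffAt_extChartAt (I := 𝓡 d))]
    have h1 : mderiv (𝓡 d) (𝓡 d) e x = ContinuousLinearMap.id ℝ (Model d) :=
      mfderiv_extChartAt_self
    have h2 : mderiv (𝓡 d) (𝓡 (n - d))
        (fun z : Model d => A (z - e x) + (Φ.chart g).2) (e x) = A := by
      have h3 : HasFDerivAt (fun z : Model d => A (z - e x) + (Φ.chart g).2) A (e x) :=
        (A.hasFDerivAt.comp (e x) ((hasFDerivAt_id _).sub_const _)).add_const _
      exact mfderiv_eq_fderiv.trans h3.fderiv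
    rw [h1, h2, ContinuousLinearMap.comp_id]
  have hpair : ContMDiffAt (𝓡 d) ((𝓡 d).prod (𝓡 (n - d))) ∞ (fun y => (y, f y)) x :=
    contMDiffAt_id.prodMk hf
  have htarget : ∀ᶠ y in 𝓝 x, (y, f y) ∈ Φ.chart.target := by
    refine hpair.continuousAt.eventually (Φ.chart.open_target.mem_nhds ?_)
    change (x, f x) ∈ Φ.chart.target
    rw [hfx]
    exact Φ.mem_target hΦ
  refine ⟨fun y => Φ.chart.symm (y, f y), ⟨?_, ?_⟩, ?_, ?_⟩
  · exact ContMDiffAt.comp_of_eq (g := Φ.chart.symm) hΨ hpair (by rw [hfx])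
  · filter_upwards [htarget] with y hy
    exact Φ.proj_symm hy
  · change Φ.chart.symm (x, f x) = g
    rw [hfx]
    exact Φ.symm_snd hΦ
  · have h1 : Γ.jet (fun y => Φ.chart.symm (y, f y)) x =
        (mderiv ((𝓡 d).prod (𝓡 (n - d))) (𝓡 n) Φ.chart.symm (x, (Φ.chart g).2)).comp
          ((ContinuousLinearMap.id ℝ (Model d)).prod A) := by
      rw [jet, mderiv_comp (f := fun y => (y, f y)) (by rw [hfx]) hΨ hpair,
        mderiv_prodMk (f := fun y => y) contMDiffAt_id hf, mderiv_id, hdf]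
    have h2 : mderiv (𝓡 n) (𝓡 n) (fun a => Φ.chart.symm (Γ.proj a, (Φ.chart a).2)) g =
        ContinuousLinearMap.id ℝ (Model n) := by
      rw [← mderiv_id (I := 𝓡 n) g]
      refine mderiv_congr ?_
      filter_upwards [Φ.chart.open_source.mem_nhds hΦ] with a ha
      exact Φ.symm_snd ha
    rw [mderiv_comp (f := fun a => (Γ.proj a, (Φ.chart a).2)) rfl hΨ
      ((Γ.contMDiff_proj g).prodMk (Φ.contMDiffAt_snd hΦ)),
      mderiv_prodMk (Γ.contMDiff_proj g) (Φ.contMDiffAt_snd hΦ)] at h2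
    rw [h1, ← ContinuousLinearMap.id_comp L, ← h2, ContinuousLinearMap.comp_assoc]
    congr 1
    exact ContinuousLinearMap.ext fun v =>
      Prod.ext (congrArg (fun B => B v) hL).symm rfl

end Realization

end SmoothGroupBundle

/-! ### Affine combinations of linear maps. -/

section Combinations

variable {ι : Type*} {E F G H : Type*} [NormedAddCommGroup E] [NormedSpace ℝ E]
  [NormedAddCommGroup F] [NormedSpace ℝ F] [NormedAddCommGroup G] [NormedSpace ℝ G]
  [NormedAddCommGroup H] [NormedSpace ℝ H]

/-- The condition on `α i` is required only where `p i ≠ 0`, because the local lifts to be glued are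
meaningful only in their own chart. -/
theorem ContinuousLinearMap.comp_sum_smul_eq {I : Finset ι} {p : ι → ℝ} (hp : ∑ i ∈ I, p i = 1)
    (L : F →L[ℝ] G) {α : ι → E →L[ℝ] F} {C : E →L[ℝ] G} (h : ∀ i, p i ≠ 0 → L.comp (α i) = C) :
    L.comp (∑ i ∈ I, p i • α i) = C := by
  rw [ContinuousLinearMap.comp_finsetSum]
  have h1 : ∀ i ∈ I, L.comp (p i • α i) = p i • C := by
    intro i _
    rw [ContinuousLinearMap.comp_smul]
    by_cases hi : p i = 0
    · rw [hi, zero_smul, zero_smul]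
    · rw [h i hi]
  rw [Finset.sum_congr rfl h1, ← Finset.sum_smul, hp, one_smul]

/-- `B` is a sum of a map of each component and is not bilinear; the double sum appears because each
family of weights has total mass one. -/
theorem ContinuousLinearMap.comp_prod_sum_smul {I J : Finset ι} {p q : ι → ℝ}
    (hp : ∑ i ∈ I, p i = 1) (hq : ∑ j ∈ J, q j = 1) (B : (F × G) →L[ℝ] H) (α : ι → E →L[ℝ] F)
    (β : ι → E →L[ℝ] G) :
    B.comp ((∑ i ∈ I, p i • α i).prod (∑ j ∈ J, q j • β j)) =
      ∑ i ∈ I, ∑ j ∈ J, (p i * q j) • B.comp ((α i).prod (β j)) := by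
  have hsplit : ∀ (a : E →L[ℝ] F) (b : E →L[ℝ] G), B.comp (a.prod b) =
      (B.comp (ContinuousLinearMap.inl ℝ F G)).comp a +
        (B.comp (ContinuousLinearMap.inr ℝ F G)).comp b := by
    intro a b
    ext v
    simp only [ContinuousLinearMap.comp_apply, ContinuousLinearMap.inl_apply,
      ContinuousLinearMap.inr_apply, ContinuousLinearMap.prod_apply, add_apply]
    rw [← map_add, Prod.mk_add_mk, add_zero, zero_add]
  simp only [hsplit, ContinuousLinearMap.comp_finsetSum, ContinuousLinearMap.comp_smul, smul_add,
    Finset.sum_add_distrib, mul_smul]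
  congr 1
  · refine Finset.sum_congr rfl fun i _ => ?_
    rw [← Finset.smul_sum, ← Finset.sum_smul, hq, one_smul]
  · simp only [← Finset.smul_sum]
    rw [← Finset.sum_smul, hp, one_smul]

end Combinations

namespace SmoothGroupBundle

variable {d n k : ℕ} {M : Type u} [TopologicalSpace M] [ChartedSpace (Model d) M]
  {N : Type v} [TopologicalSpace N] [ChartedSpace (Model n) N]
  {Γ : SmoothGroupBundle d n M N}

/-! ### The averaged connection -/

section SliceSection

variable (Φ : SliceChart (d := d) (n := n) k Γ.proj)

/-- The local section through `g` which is constant in a slice chart. -/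
def sliceSection (g : N) (x : M) : N := Φ.chart.symm (x, (Φ.chart g).2)

variable {Φ}

theorem sliceSection_apply {g : N} (hg : g ∈ Φ.chart.source) :
    Γ.sliceSection Φ g (Γ.proj g) = g := Φ.symm_snd hg

theorem isSectionAt_sliceSection {g : N} (hg : g ∈ Φ.chart.source) :
    Γ.IsSectionAt (Γ.sliceSection Φ g) (Γ.proj g) := by
  refine ⟨ContMDiffAt.comp (Γ.proj g) (g := Φ.chart.symm) (f := fun x => (x, (Φ.chart g).2))
    (Φ.contMDiffAt_symm (Φ.mem_target hg)) (contMDiffAt_id.prodMk contMDiffAt_const), ?_⟩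
  filter_upwards [(Continuous.prodMk_left (Φ.chart g).2).continuousAt.eventually
    (Φ.chart.open_target.mem_nhds (Φ.mem_target hg))] with x hx
  exact Φ.proj_symm hx

theorem contMDiffAt_sliceSection {E' : Type*} [NormedAddCommGroup E'] [NormedSpace ℝ E']
    {H' : Type*} [TopologicalSpace H'] {J : ModelWithCorners ℝ E' H'} {P : Type*}
    [TopologicalSpace P] [ChartedSpace H' P] {a : P → N} {p : P} (ha : ContMDiffAt J (𝓡 n) ∞ a p)
    (hs : a p ∈ Φ.chart.source) :
    ContMDiffAt (J.prod (𝓡 d)) (𝓡 n) ∞ (fun q : P × M => Γ.sliceSection Φ (a q.1) q.2)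
      (p, Γ.proj (a p)) := by
  have h1 : ContMDiffAt (J.prod (𝓡 d)) (𝓡 n) ∞ (fun q : P × M => a q.1) (p, Γ.proj (a p)) :=
    ContMDiffAt.comp (p, Γ.proj (a p)) (g := a) (f := Prod.fst) ha contMDiffAt_fst
  have h2 : ContMDiffAt (J.prod (𝓡 d)) (𝓡 k) ∞ (fun q : P × M => (Φ.chart (a q.1)).2)
      (p, Γ.proj (a p)) :=
    ContMDiffAt.comp (p, Γ.proj (a p)) (g := fun b => (Φ.chart b).2) (f := fun q : P × M => a q.1)
      (Φ.contMDiffAt_snd hs) h1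
  exact ContMDiffAt.comp (p, Γ.proj (a p)) (g := Φ.chart.symm)
    (f := fun q : P × M => (q.2, (Φ.chart (a q.1)).2))
    (Φ.contMDiffAt_symm (Φ.mem_target hs)) (contMDiffAt_snd.prodMk h2)

theorem eventually_proj_sliceSection {P : Type*} [TopologicalSpace P] {a : P → N} {p : P}
    (ha : ContinuousAt a p) (hs : a p ∈ Φ.chart.source) :
    ∀ᶠ q in 𝓝 (p, Γ.proj (a p)), Γ.proj (Γ.sliceSection Φ (a q.1) q.2) = q.2 := by
  have h1 : ContinuousAt (fun q : P × M => a q.1) (p, Γ.proj (a p)) :=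
    ContinuousAt.comp (g := a) (f := Prod.fst) ha continuousAt_fst
  have h2 : ContinuousAt (fun q : P × M => (q.2, (Φ.chart (a q.1)).2)) (p, Γ.proj (a p)) :=
    continuousAt_snd.prodMk (ContinuousAt.comp (g := fun b => (Φ.chart b).2)
      (Φ.contMDiffAt_snd hs).continuousAt h1)
  filter_upwards [h2.eventually (Φ.chart.open_target.mem_nhds (Φ.mem_target hs))] with q hq
  exact Φ.proj_symm hq

end SliceSection

namespace SlicePartition

variable (A : Γ.SlicePartition k)

/-- A connection obtained by gluing the local connections of slice charts. -/
def gluedLift (g : N) : Model d →L[ℝ] Model n :=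
  ∑ᶠ i, A.χ i g • Γ.jet (Γ.sliceSection (A.Φ i) g) (Γ.proj g)

theorem gluedLift_eq_sum {I : Finset A.ι} {g : N} (hI : ∀ i ∉ I, A.χ i g = 0) :
    A.gluedLift g = ∑ i ∈ I, A.χ i g • Γ.jet (Γ.sliceSection (A.Φ i) g) (Γ.proj g) := by
  refine finsum_eq_sum_of_support_subset _ fun i hi => ?_
  by_contra hiI
  refine hi ?_
  simp only [hI i (by simpa using hiI)]
  exact zero_smul ℝ (_ : Model d →L[ℝ] Model n)

theorem exists_finset_eventually (g : N) :
    ∃ I : Finset A.ι, ∀ᶠ a in 𝓝 g, ∀ i ∉ I, A.χ i a = 0 := by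
  refine ⟨A.χ.fintsupport g, ?_⟩
  filter_upwards [A.χ.eventually_finsupport_subset g] with a ha i hi
  by_contra h
  exact hi (ha ((A.χ.mem_finsupport a).2 h))

variable [IsManifold (𝓡 d) ∞ M] [IsManifold (𝓡 n) ∞ N]

theorem mderiv_proj_comp_gluedLift (g : N) :
    (mderiv (𝓡 n) (𝓡 d) Γ.proj g).comp (A.gluedLift g) = ContinuousLinearMap.id ℝ (Model d) := by
  obtain ⟨I, hI⟩ := A.exists_finset_eventually g
  rw [A.gluedLift_eq_sum hI.self_of_nhds]
  exact ContinuousLinearMap.comp_sum_smul_eq (A.sum_eq_one hI.self_of_nhds) _ fun i hi =>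
    (isSectionAt_sliceSection (A.mem_source_of_ne hi)).mderiv_proj_comp_jet
      (sliceSection_apply (A.mem_source_of_ne hi))

/-- A local section through `g` which is tangent to the glued connection. -/
def horizontalSection (g : N) : M → N :=
  (exists_isSectionAt g (A.mderiv_proj_comp_gluedLift g)).choose

theorem isSectionAt_horizontalSection (g : N) :
    Γ.IsSectionAt (A.horizontalSection g) (Γ.proj g) :=
  (exists_isSectionAt g (A.mderiv_proj_comp_gluedLift g)).choose_spec.1

theorem horizontalSection_apply (g : N) : A.horizontalSection g (Γ.proj g) = g :=
  (exists_isSectionAt g (A.mderiv_proj_comp_gluedLift g)).choose_spec.2.1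

theorem jet_horizontalSection (g : N) :
    Γ.jet (A.horizontalSection g) (Γ.proj g) = A.gluedLift g :=
  (exists_isSectionAt g (A.mderiv_proj_comp_gluedLift g)).choose_spec.2.2

/-- The quotient of the horizontal sections through `g * a` and through `a`. -/
def quotientSection (g a : N) (x : M) : N :=
  Γ.mul (A.horizontalSection (Γ.mul g a) x) (Γ.inv (A.horizontalSection a x))

/-- The jet of the quotient of the horizontal sections through `g * a` and through `a`. -/
def quotientLift (g a : N) : Model d →L[ℝ] Model n :=
  Γ.jet (A.quotientSection g a) (Γ.proj g)

variable {g a b : N}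

theorem isSectionAt_quotientSection (h : Γ.proj g = Γ.proj a) :
    Γ.IsSectionAt (A.quotientSection g a) (Γ.proj g) := by
  have h1 := A.isSectionAt_horizontalSection (Γ.mul g a)
  rw [Γ.proj_mul h, ← h] at h1
  exact h1.mul (h ▸ (A.isSectionAt_horizontalSection a).inv)

theorem quotientSection_apply (h : Γ.proj g = Γ.proj a) :
    A.quotientSection g a (Γ.proj g) = g := by
  have h1 := A.horizontalSection_apply (Γ.mul g a)
  rw [Γ.proj_mul h, ← h] at h1
  have h2 := A.horizontalSection_apply a
  rw [← h] at h2
  rw [quotientSection, h1, h2, Γ.mul_inv_cancel_right h]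

/-- With `σ` the horizontal sections, `(σ_{gab} σ_{ab}⁻¹)(σ_{ab} σ_b⁻¹) = σ_{gab} σ_b⁻¹` holds for
the sections themselves near the base point. -/
theorem jet_mul_quotientSection (h : Γ.proj g = Γ.proj a) (h' : Γ.proj a = Γ.proj b) :
    Γ.jet (fun x => Γ.mul (A.quotientSection g (Γ.mul a b) x) (A.quotientSection a b x))
      (Γ.proj a) = A.quotientLift (Γ.mul g a) b := by
  rw [quotientLift, Γ.proj_mul h]
  refine mderiv_congr ?_
  have h1 := A.isSectionAt_horizontalSection (Γ.mul g (Γ.mul a b))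
  have h2 := A.isSectionAt_horizontalSection (Γ.mul a b)
  have h3 := A.isSectionAt_horizontalSection b
  rw [Γ.proj_mul (h.trans (h'.trans (Γ.proj_mul h').symm)), Γ.proj_mul h', ← h'] at h1
  rw [Γ.proj_mul h', ← h'] at h2
  rw [← h'] at h3
  filter_upwards [h1.proj_eq, h2.proj_eq, h3.proj_eq] with x e1 e2 e3
  simp only [quotientSection]
  rw [Γ.mul_assoc h h', Γ.mul_assoc (by rw [e1, Γ.proj_inv, e2])
    (by rw [Γ.proj_inv, Γ.proj_mul (by rw [e2, Γ.proj_inv, e3]), Γ.proj_inv, e2, e3]),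
    Γ.inv_mul_cancel_left (by rw [e2, Γ.proj_inv, e3])]

theorem mderiv_proj_comp_quotientLift (h : Γ.proj g = Γ.proj a) :
    (mderiv (𝓡 n) (𝓡 d) Γ.proj g).comp (A.quotientLift g a) =
      ContinuousLinearMap.id ℝ (Model d) :=
  (A.isSectionAt_quotientSection h).mderiv_proj_comp_jet (A.quotientSection_apply h)

/-- Horizontal sections are chosen arrow by arrow, with no smoothness in the arrow. Slice sections
do vary smoothly, so this expansion is what makes the smoothness of `quotientLift` accessible. -/
theorem quotientLift_eq_sum (h : Γ.proj g = Γ.proj a) {I J : Finset A.ι}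
    (hI : ∀ i ∉ I, A.χ i (Γ.mul g a) = 0) (hJ : ∀ j ∉ J, A.χ j a = 0) :
    A.quotientLift g a = ∑ i ∈ I, ∑ j ∈ J, (A.χ i (Γ.mul g a) * A.χ j a) •
      Γ.jet (fun x => Γ.mul (Γ.sliceSection (A.Φ i) (Γ.mul g a) x)
        (Γ.inv (Γ.sliceSection (A.Φ j) a x))) (Γ.proj g) := by
  have hp : Γ.proj (Γ.mul g a) = Γ.proj g := (Γ.proj_mul h).trans h.symm
  obtain ⟨B, hB⟩ := exists_divDeriv (Γ := Γ) (a := Γ.mul g a) (b := a) (Γ.proj_mul h)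
  have h1 := A.isSectionAt_horizontalSection (Γ.mul g a)
  have h1' := A.horizontalSection_apply (Γ.mul g a)
  have h1'' := A.jet_horizontalSection (Γ.mul g a)
  have h2 := A.isSectionAt_horizontalSection a
  have h2' := A.horizontalSection_apply a
  have h2'' := A.jet_horizontalSection a
  rw [hp] at h1 h1' h1''
  rw [← h] at h2 h2' h2''
  have h3 : A.quotientLift g a = B.comp ((A.gluedLift (Γ.mul g a)).prod (A.gluedLift a)) := by
    rw [← h1'', ← h2'']
    exact hB h1 h2 h1' h2'
  have hterm : ∀ i ∈ I, ∀ j ∈ J, (A.χ i (Γ.mul g a) * A.χ j a) •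
      Γ.jet (fun x => Γ.mul (Γ.sliceSection (A.Φ i) (Γ.mul g a) x)
        (Γ.inv (Γ.sliceSection (A.Φ j) a x))) (Γ.proj g) = (A.χ i (Γ.mul g a) * A.χ j a) •
      B.comp ((Γ.jet (Γ.sliceSection (A.Φ i) (Γ.mul g a)) (Γ.proj g)).prod
        (Γ.jet (Γ.sliceSection (A.Φ j) a) (Γ.proj g))) := by
    intro i _ j _
    by_cases hi : A.χ i (Γ.mul g a) = 0
    · rw [hi, zero_mul]
      exact (zero_smul ℝ (_ : Model d →L[ℝ] Model n)).trans
        (zero_smul ℝ (_ : Model d →L[ℝ] Model n)).symm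
    by_cases hj : A.χ j a = 0
    · rw [hj, mul_zero]
      exact (zero_smul ℝ (_ : Model d →L[ℝ] Model n)).trans
        (zero_smul ℝ (_ : Model d →L[ℝ] Model n)).symm
    have hsi := A.mem_source_of_ne hi
    have hsj := A.mem_source_of_ne hj
    have s1 := isSectionAt_sliceSection hsi
    have s1' := sliceSection_apply hsi
    have s2 := isSectionAt_sliceSection hsj
    have s2' := sliceSection_apply hsj
    rw [hp] at s1 s1'
    rw [← h] at s2 s2'
    rw [hB s1 s2 s1' s2']
  rw [Finset.sum_congr rfl fun i hi => Finset.sum_congr rfl (hterm i hi), h3,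
    A.gluedLift_eq_sum hI, A.gluedLift_eq_sum hJ, hp, ← h]
  exact ContinuousLinearMap.comp_prod_sum_smul (A.sum_eq_one hI) (A.sum_eq_one hJ) B _ _

end SlicePartition

end SmoothGroupBundle

section Combinations

variable {E F G H : Type*} [NormedAddCommGroup E] [NormedSpace ℝ E]
  [NormedAddCommGroup F] [NormedSpace ℝ F] [NormedAddCommGroup G] [NormedSpace ℝ G]
  [NormedAddCommGroup H] [NormedSpace ℝ H]

/-- The linear map `φ ↦ L ∘ φ ∘ R`. -/
def ContinuousLinearMap.sandwich (L : G →L[ℝ] H) (R : E →L[ℝ] F) :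
    (F →L[ℝ] G) →L[ℝ] (E →L[ℝ] H) :=
  (ContinuousLinearMap.compL ℝ E G H L).comp ((ContinuousLinearMap.compL ℝ E F G).flip R)

theorem ContinuousLinearMap.sandwich_apply (L : G →L[ℝ] H) (R : E →L[ℝ] F) (φ : F →L[ℝ] G) :
    ContinuousLinearMap.sandwich L R φ = L.comp (φ.comp R) := rfl

theorem ContinuousLinearMap.sandwich_id (φ : F →L[ℝ] G) :
    ContinuousLinearMap.sandwich (ContinuousLinearMap.id ℝ G) (ContinuousLinearMap.id ℝ F) φ = φ :=
  rfl

/-- The linear map `(φ, ψ) ↦ B (φ ·, ψ ·)`. -/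
def ContinuousLinearMap.compProd (B : (F × G) →L[ℝ] H) :
    ((E →L[ℝ] F) × (E →L[ℝ] G)) →L[ℝ] (E →L[ℝ] H) :=
  (ContinuousLinearMap.compL ℝ E F H (B.comp (ContinuousLinearMap.inl ℝ F G))).comp
    (ContinuousLinearMap.fst ℝ _ _) +
  (ContinuousLinearMap.compL ℝ E G H (B.comp (ContinuousLinearMap.inr ℝ F G))).comp
    (ContinuousLinearMap.snd ℝ _ _)

theorem ContinuousLinearMap.compProd_apply (B : (F × G) →L[ℝ] H) (φ : E →L[ℝ] F) (ψ : E →L[ℝ] G) :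
    ContinuousLinearMap.compProd B (φ, ψ) = B.comp (φ.prod ψ) := by
  ext v
  change B (φ v, 0) + B (0, ψ v) = B (φ v, ψ v)
  rw [← map_add, Prod.mk_add_mk, add_zero, zero_add]

theorem ContinuousLinearMap.compProd_smul (B : (F × G) →L[ℝ] H) (c : ℝ) (φ : E →L[ℝ] F)
    (ψ : E →L[ℝ] G) :
    c • ContinuousLinearMap.compProd B (φ, ψ) = B.comp ((c • φ).prod (c • ψ)) := by
  rw [← map_smul, Prod.smul_mk, ContinuousLinearMap.compProd_apply]

theorem ContinuousLinearMap.sandwich_sum {ι : Type*} {I J : Finset ι} {c : ι → ι → ℝ}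
    (L : G →L[ℝ] H) (R : E →L[ℝ] F) (φ : ι → ι → F →L[ℝ] G) :
    ContinuousLinearMap.sandwich L R (∑ i ∈ I, ∑ j ∈ J, c i j • φ i j) =
      ∑ i ∈ I, ∑ j ∈ J, c i j • L.comp ((φ i j).comp R) := by
  simp only [map_sum, map_smul, ContinuousLinearMap.sandwich_apply]

end Combinations

/-! ### Smoothness of the quotient jets, and their average. -/

namespace SmoothGroupBundle

variable {d n k : ℕ} {M : Type u} [TopologicalSpace M] [ChartedSpace (Model d) M]
  {N : Type v} [TopologicalSpace N] [ChartedSpace (Model n) N]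
  {Γ : SmoothGroupBundle d n M N}

/-- The expression of linear maps `T_{proj g} M → T_g N` in the charts around `proj g₀`, `g₀`. -/
def coordinates (Γ : SmoothGroupBundle d n M N) (g₀ g : N) :
    (Model d →L[ℝ] Model n) →L[ℝ] (Model d →L[ℝ] Model n) :=
  ContinuousLinearMap.sandwich (mderiv (𝓡 n) (𝓡 n) (extChartAt (𝓡 n) g₀) g)
    (mderiv (𝓡 d) (𝓡 d) (extChartAt (𝓡 d) (Γ.proj g₀)).symm
      (extChartAt (𝓡 d) (Γ.proj g₀) (Γ.proj g)))

/-- The domain of the coordinates `Γ.coordinates g₀`. -/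
def coordinateDomain (Γ : SmoothGroupBundle d n M N) (g₀ : N) : Set N :=
  (chartAt (Model n) g₀).source ∩ Γ.proj ⁻¹' (chartAt (Model d) (Γ.proj g₀)).source

theorem mem_coordinateDomain (g₀ : N) : g₀ ∈ Γ.coordinateDomain g₀ :=
  ⟨mem_chart_source _ _, mem_chart_source _ _⟩

variable [IsManifold (𝓡 d) ∞ M] [IsManifold (𝓡 n) ∞ N]

theorem isOpen_coordinateDomain (g₀ : N) : IsOpen (Γ.coordinateDomain g₀) :=
  (chartAt (Model n) g₀).open_source.inter
    ((chartAt (Model d) (Γ.proj g₀)).open_source.preimage Γ.contMDiff_proj.continuous)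

theorem coordinates_self (g₀ : N) (φ : Model d →L[ℝ] Model n) : Γ.coordinates g₀ g₀ φ = φ := by
  have h1 : mderiv (𝓡 n) (𝓡 n) (extChartAt (𝓡 n) g₀) g₀ = ContinuousLinearMap.id ℝ (Model n) :=
    mfderiv_extChartAt_self
  have h2 : mderiv (𝓡 d) (𝓡 d) (extChartAt (𝓡 d) (Γ.proj g₀)).symm
      (extChartAt (𝓡 d) (Γ.proj g₀) (Γ.proj g₀)) = ContinuousLinearMap.id ℝ (Model d) := by
    have h3 := mfderivWithin_range_extChartAt_symm (I := 𝓡 d) (x := Γ.proj g₀)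
    simp only [modelWithCornersSelf_coe, Set.range_id, mfderivWithin_univ] at h3
    exact h3
  rw [coordinates, h1, h2, ContinuousLinearMap.sandwich_id]

theorem inTangentCoordinates_eq_coordinates {g₀ g : N} (hg : g ∈ Γ.coordinateDomain g₀)
    (η : N → Model d →L[ℝ] Model n) :
    inTangentCoordinates (𝓡 d) (𝓡 n) Γ.proj id η g₀ g = Γ.coordinates g₀ g (η g) := by
  have h := inTangentCoordinates_eq_mfderiv_comp (I := 𝓡 d) (I' := 𝓡 n) (f := Γ.proj) (g := id)
    (ϕ := η) (x₀ := g₀) (x := g) hg.2 hg.1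
  simp only [modelWithCornersSelf_coe, Set.range_id, mfderivWithin_univ] at h
  exact h

namespace SlicePartition

variable (A : Γ.SlicePartition k)

theorem fiberSmooth_quotientLift (g₀ : N) :
    A.FiberSmooth (Γ.coordinateDomain g₀)
      (fun g a => Γ.coordinates g₀ g (A.quotientLift g a)) := by
  rintro g₁ hg₁ l h₁ hl hp
  let y₁ := ((A.Φ l).chart h₁).2
  -- For `p = (g, y)`, the arrow `K p` is the integration variable `a` and `T p` is the product `g
  -- a`.
  let K : N × Model k → N := fun p => (A.Φ l).chart.symm (Γ.proj p.1, p.2)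
  let T : N × Model k → N := fun p => Γ.mul p.1 (K p)
  have ht : (Γ.proj g₁, y₁) ∈ (A.Φ l).chart.target := hp ▸ (A.Φ l).mem_target hl
  have hK₁ : K (g₁, y₁) = h₁ := by
    have := (A.Φ l).symm_snd hl
    rwa [hp] at this
  have hT₁ : T (g₁, y₁) = Γ.mul g₁ h₁ := congrArg (Γ.mul g₁) hK₁
  have hpK : ∀ᶠ p in 𝓝 (g₁, y₁), Γ.proj (K p) = Γ.proj p.1 := by
    filter_upwards [eventually_symm_proj ht] with p hp'
    exact (A.Φ l).proj_symm hp'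
  have hKs : ContMDiffAt ((𝓡 n).prod (𝓡 k)) (𝓡 n) ∞ K (g₁, y₁) := contMDiffAt_symm_proj ht
  have hTs : ContMDiffAt ((𝓡 n).prod (𝓡 k)) (𝓡 n) ∞ T (g₁, y₁) := contMDiffAt_mul_symm ht
  obtain ⟨I, hI⟩ := A.exists_finset_eventually (T (g₁, y₁))
  obtain ⟨J, hJ⟩ := A.exists_finset_eventually (K (g₁, y₁))
  let S : A.ι → A.ι → N × Model k → M → N := fun i j p x =>
    Γ.mul (Γ.sliceSection (A.Φ i) (T p) x) (Γ.inv (Γ.sliceSection (A.Φ j) (K p) x))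
  have hpT : ∀ p : N × Model k, Γ.proj (K p) = Γ.proj p.1 → Γ.proj (T p) = Γ.proj p.1 :=
    fun p h => (Γ.proj_mul h.symm).trans h
  have hterm : ∀ i ∈ I, ∀ j ∈ J, ContMDiffAt ((𝓡 n).prod (𝓡 k)) 𝓘(ℝ, Model d →L[ℝ] Model n) ∞
      (fun p : N × Model k => (A.χ i (T p) * A.χ j (K p)) •
        (mderiv (𝓡 n) (𝓡 n) (extChartAt (𝓡 n) g₀) p.1).comp
          ((Γ.jet (S i j p) (Γ.proj p.1)).comp
            (mderiv (𝓡 d) (𝓡 d) (extChartAt (𝓡 d) (Γ.proj g₀)).symm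
              (extChartAt (𝓡 d) (Γ.proj g₀) (Γ.proj p.1))))) (g₁, y₁) := by
    intro i _ j _
    by_cases hi : T (g₁, y₁) ∈ tsupport (A.χ i)
    swap
    · refine (contMDiffAt_const (c := (0 : Model d →L[ℝ] Model n))).congr_of_eventuallyEq ?_
      filter_upwards [hTs.continuousAt.eventually
        ((isClosed_tsupport (A.χ i)).isOpen_compl.mem_nhds hi)] with p hp
      rw [image_eq_zero_of_notMem_tsupport hp, zero_mul]
      exact zero_smul ℝ (_ : Model d →L[ℝ] Model n)
    by_cases hj : K (g₁, y₁) ∈ tsupport (A.χ j)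
    swap
    · refine (contMDiffAt_const (c := (0 : Model d →L[ℝ] Model n))).congr_of_eventuallyEq ?_
      filter_upwards [hKs.continuousAt.eventually
        ((isClosed_tsupport (A.χ j)).isOpen_compl.mem_nhds hj)] with p hp
      rw [image_eq_zero_of_notMem_tsupport hp, mul_zero]
      exact zero_smul ℝ (_ : Model d →L[ℝ] Model n)
    have hsi := A.mem_source hi
    have hsj := A.mem_source hj
    have hc1 : ContMDiffAt ((𝓡 n).prod (𝓡 k)) 𝓘(ℝ) ∞ (fun p => A.χ i (T p)) (g₁, y₁) :=
      ContMDiffAt.comp (g₁, y₁) (g := A.χ i) ((A.χ i).contMDiff _) hTs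
    have hc2 : ContMDiffAt ((𝓡 n).prod (𝓡 k)) 𝓘(ℝ) ∞ (fun p => A.χ j (K p)) (g₁, y₁) :=
      ContMDiffAt.comp (g₁, y₁) (g := A.χ j) ((A.χ j).contMDiff _) hKs
    refine (hc1.mul hc2).smul ?_
    have e1 := hpK.self_of_nhds
    have e2 := hpT _ e1
    have s1 := contMDiffAt_sliceSection hTs hsi
    have s2 := contMDiffAt_sliceSection hKs hsj
    have s3 := eventually_proj_sliceSection hTs.continuousAt hsi
    have s4 := eventually_proj_sliceSection hKs.continuousAt hsj
    rw [e2] at s1 s3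
    rw [e1] at s2 s4
    have hS : ContMDiffAt (((𝓡 n).prod (𝓡 k)).prod (𝓡 d)) (𝓡 n) ∞ (Function.uncurry (S i j))
        ((g₁, y₁), Γ.proj g₁) := by
      refine Γ.contMDiffAt_mul s1 (Γ.contMDiffAt_inv s2) ?_
      filter_upwards [s3, s4] with q h3 h4
      rw [h3, Γ.proj_inv, h4]
    -- Since `(g a) a⁻¹ = g`, the quotient section passes through `g`, so the chart derivative at
    -- its value is the one used in `coordinates`.
    have hSb : ∀ᶠ p in 𝓝 (g₁, y₁), S i j p (Γ.proj p.1) = p.1 := by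
      filter_upwards [hpK, hTs.continuousAt.eventually ((A.Φ i).chart.open_source.mem_nhds hsi),
        hKs.continuousAt.eventually ((A.Φ j).chart.open_source.mem_nhds hsj)] with p h1 h2 h3
      have h4 := sliceSection_apply h2
      have h5 := sliceSection_apply h3
      rw [hpT p h1] at h4
      rw [h1] at h5
      change Γ.mul (Γ.sliceSection (A.Φ i) (T p) (Γ.proj p.1))
        (Γ.inv (Γ.sliceSection (A.Φ j) (K p) (Γ.proj p.1))) = p.1
      rw [h4, h5, Γ.mul_inv_cancel_right h1.symm]
    have hb : ContMDiffAt ((𝓡 n).prod (𝓡 k)) (𝓡 d) ∞ (fun p : N × Model k => Γ.proj p.1)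
        (g₁, y₁) := (Γ.contMDiff_proj _).comp _ contMDiffAt_fst
    refine (contMDiffAt_mderiv_inCoordinates (S := S i j) (x₀ := Γ.proj g₀) (g₀ := g₀) hS hb hg₁.2
      (by rw [hSb.self_of_nhds]; exact hg₁.1)).congr_of_eventuallyEq ?_
    filter_upwards [hSb] with p hp
    rw [hp]
  refine (contMDiffAt_finsetSum fun i hi => contMDiffAt_finsetSum fun j hj =>
    hterm i hi j hj).congr_of_eventuallyEq ?_
  filter_upwards [hpK, hTs.continuousAt.eventually hI, hKs.continuousAt.eventually hJ]
    with p h1 h2 h3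
  have h4 := A.quotientLift_eq_sum h1.symm h2 h3
  refine (congrArg (Γ.coordinates g₀ p.1) h4).trans ?_
  exact ContinuousLinearMap.sandwich_sum _ _ _

variable [T2Space M]

/-- In coordinates centred at `g` itself the coordinate map at `g` is the identity. -/
theorem continuousOn_quotientLift (g : N) :
    ContinuousOn (A.quotientLift g) (Γ.proj ⁻¹' {Γ.proj g}) := by
  have h := (A.fiberSmooth_quotientLift g).continuousOn (mem_coordinateDomain g)
  simp only [coordinates_self] at h
  exact h

/-- The connection obtained by averaging the quotients of horizontal sections. -/
def averagedLift (g : N) : Model d →L[ℝ] Model n :=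
  (A.fiberIntegral (Γ.proj g) (fun _ => (1 : ℝ)))⁻¹ •
    A.fiberIntegral (Γ.proj g) (A.quotientLift g)

theorem contMDiffAt_averagedLift (g₀ : N) :
    ContMDiffAt (𝓡 n) 𝓘(ℝ, Model d →L[ℝ] Model n) ∞
      (inTangentCoordinates (𝓡 d) (𝓡 n) Γ.proj id A.averagedLift g₀) g₀ := by
  have h1 := (A.fiberSmooth_quotientLift g₀).contMDiffAt_fiberIntegral
    (isOpen_coordinateDomain (Γ := Γ) g₀) (mem_coordinateDomain (Γ := Γ) g₀)
  have h2 : A.FiberSmooth Set.univ (fun _ _ => (1 : ℝ)) :=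
    fun _ _ _ _ _ _ => contMDiffAt_const
  have h3 := h2.contMDiffAt_fiberIntegral isOpen_univ (Set.mem_univ g₀)
  have h4 : ContMDiffAt (𝓡 n) 𝓘(ℝ) ∞
      (fun g => (A.fiberIntegral (Γ.proj g) (fun _ => (1 : ℝ)))⁻¹) g₀ :=
    ContMDiffAt.comp g₀ (g := fun t : ℝ => t⁻¹)
      (contDiffAt_inv ℝ (A.fiberIntegral_const_pos g₀).ne').contMDiffAt h3
  refine (h4.smul h1).congr_of_eventuallyEq ?_
  filter_upwards [(isOpen_coordinateDomain (Γ := Γ) g₀).mem_nhds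
    (mem_coordinateDomain (Γ := Γ) g₀)] with g hg
  rw [inTangentCoordinates_eq_coordinates hg, averagedLift]
  -- For fixed `g` the passage to coordinates is a single linear map and can be moved under the
  -- integral.
  refine (map_smul _ _ _).trans ?_
  exact congrArg ((A.fiberIntegral (Γ.proj g) (fun _ => (1 : ℝ)))⁻¹ • ·)
    (A.fiberIntegral_clm (Γ.coordinates g₀ g) (A.continuousOn_quotientLift g)).symm

theorem mderiv_proj_comp_averagedLift (g : N) :
    (mderiv (𝓡 n) (𝓡 d) Γ.proj g).comp (A.averagedLift g) = ContinuousLinearMap.id ℝ (Model d) := by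
  let P := ContinuousLinearMap.compL ℝ (Model d) (Model n) (Model d) (mderiv (𝓡 n) (𝓡 d) Γ.proj g)
  let Q : ℝ →L[ℝ] (Model d →L[ℝ] Model d) :=
    ContinuousLinearMap.toSpanSingleton ℝ (ContinuousLinearMap.id ℝ (Model d))
  have h1 : P (A.fiberIntegral (Γ.proj g) (A.quotientLift g)) =
      Q (A.fiberIntegral (Γ.proj g) (fun _ => (1 : ℝ))) := by
    rw [← A.fiberIntegral_clm P (A.continuousOn_quotientLift g),
      ← A.fiberIntegral_clm Q continuousOn_const]
    refine A.fiberIntegral_congr fun a ha => ?_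
    refine (A.mderiv_proj_comp_quotientLift ha.symm).trans ?_
    exact (one_smul ℝ (_ : Model d →L[ℝ] Model d)).symm
  have h2 : P (A.averagedLift g) = (A.fiberIntegral (Γ.proj g) (fun _ => (1 : ℝ)))⁻¹ •
      Q (A.fiberIntegral (Γ.proj g) (fun _ => (1 : ℝ))) := by
    rw [← h1]
    exact map_smul _ _ _
  refine h2.trans ?_
  rw [← map_smul, smul_eq_mul, inv_mul_cancel₀ (A.fiberIntegral_const_pos g).ne']
  exact one_smul ℝ (_ : Model d →L[ℝ] Model d)

/-- Telescoping writes the integrand for `ab` as `B` applied to a pair. After `B` leaves the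
integral, the first component is the integral of `δ(a, bc)` over `c`, and left invariance replaces
`bc` by `c`. The normalizing factor is common, all three arrows lying in one fibre. -/
theorem averagedLift_mul {a b : N} (h : Γ.proj a = Γ.proj b)
    {B : (Model n × Model n) →L[ℝ] Model n}
    (hB : ∀ {σ τ : M → N} {x : M}, Γ.IsSectionAt σ x → Γ.IsSectionAt τ x → σ x = a → τ x = b →
      Γ.jet (fun y => Γ.mul (σ y) (τ y)) x = B.comp ((Γ.jet σ x).prod (Γ.jet τ x))) :
    A.averagedLift (Γ.mul a b) = B.comp ((A.averagedLift a).prod (A.averagedLift b)) := by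
  have hmul := continuousOn_mul_left (Γ := Γ) b
  have hmaps : Set.MapsTo (Γ.mul b) (Γ.proj ⁻¹' {Γ.proj b}) (Γ.proj ⁻¹' {Γ.proj b}) := by
    intro c hc
    rw [Set.mem_preimage, Γ.proj_mul (Eq.symm hc)]
    exact hc
  have hca := A.continuousOn_quotientLift a
  rw [h] at hca
  have hc1 : ContinuousOn (fun c => A.quotientLift a (Γ.mul b c)) (Γ.proj ⁻¹' {Γ.proj b}) :=
    hca.comp hmul hmaps
  have hc2 := A.continuousOn_quotientLift b
  have hpair := hc1.prodMk hc2
  have h1 : A.fiberIntegral (Γ.proj b) (A.quotientLift (Γ.mul a b)) =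
      A.fiberIntegral (Γ.proj b) (fun c => ContinuousLinearMap.compProd B
        (A.quotientLift a (Γ.mul b c), A.quotientLift b c)) := by
    refine A.fiberIntegral_congr fun c hc => ?_
    have hbc : Γ.proj a = Γ.proj (Γ.mul b c) := h.trans (hc.symm.trans (Γ.proj_mul hc.symm).symm)
    have s1 := A.isSectionAt_quotientSection hbc
    have s1' := A.quotientSection_apply hbc
    have s2 := A.isSectionAt_quotientSection hc.symm
    have s2' := A.quotientSection_apply hc.symm
    rw [h] at s1 s1'
    rw [← A.jet_mul_quotientSection h hc.symm, ContinuousLinearMap.compProd_apply,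
      hB s1 s2 s1' s2', quotientLift, quotientLift, h]
  have h2 := A.fiberIntegral_clm (ContinuousLinearMap.compProd B) hpair
  have h3 := A.fiberIntegral_clm (ContinuousLinearMap.fst ℝ _ _) hpair
  have h4 := A.fiberIntegral_clm (ContinuousLinearMap.snd ℝ _ _) hpair
  have h5 := A.fiberIntegral_mul_left b hca
  rw [averagedLift, averagedLift, averagedLift, Γ.proj_mul h, h, h1, h2,
    ← ContinuousLinearMap.compProd_smul]
  congr 2
  refine Prod.ext ?_ ?_
  · exact h3.symm.trans h5
  · exact h4.symm

end SlicePartition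

/-! ### Multiplicative lifts: products determine units and inverses. -/

/-- A smooth connection whose horizontal jets are closed under multiplication. -/
structure IsMultiplicativeLift (Γ : SmoothGroupBundle d n M N) (η : N → Model d →L[ℝ] Model n) :
    Prop where
  smooth : ∀ g₀, ContMDiffAt (𝓡 n) 𝓘(ℝ, Model d →L[ℝ] Model n) ∞
    (inTangentCoordinates (𝓡 d) (𝓡 n) Γ.proj id η g₀) g₀
  mderiv_proj_comp : ∀ g,
    (mderiv (𝓡 n) (𝓡 d) Γ.proj g).comp (η g) = ContinuousLinearMap.id ℝ (Model d)
  jet_mul : ∀ {σ τ : M → N} {x : M}, Γ.IsSectionAt σ x → Γ.IsSectionAt τ x →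
    Γ.jet σ x = η (σ x) → Γ.jet τ x = η (τ x) →
      Γ.jet (fun y => Γ.mul (σ y) (τ y)) x = η (Γ.mul (σ x) (τ x))

theorem exists_isMultiplicativeLift [T2Space M] [T2Space N] [SigmaCompactSpace N]
    (Γ : SmoothGroupBundle d n M N) : ∃ η, Γ.IsMultiplicativeLift η := by
  obtain ⟨A⟩ := Γ.exists_slicePartition
  refine ⟨A.averagedLift, A.contMDiffAt_averagedLift, A.mderiv_proj_comp_averagedLift, ?_⟩
  intro σ τ x hσ hτ h1 h2
  have h : Γ.proj (σ x) = Γ.proj (τ x) := hσ.proj_apply.trans hτ.proj_apply.symm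
  obtain ⟨B, hB⟩ := exists_mulDeriv h
  rw [hB hσ hτ rfl rfl, h1, h2, A.averagedLift_mul h hB]

namespace IsMultiplicativeLift

variable {η : N → Model d →L[ℝ] Model n}

theorem exists_isSectionAt (hη : Γ.IsMultiplicativeLift η) (g : N) :
    ∃ σ, Γ.IsSectionAt σ (Γ.proj g) ∧ σ (Γ.proj g) = g ∧ Γ.jet σ (Γ.proj g) = η g :=
  SmoothGroupBundle.exists_isSectionAt g (hη.mderiv_proj_comp g)

/-- A horizontal section `σ` through the unit has an idempotent jet, as `1 · 1 = 1`. Multiplication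
by the jet of `σ⁻¹` cancels one factor, leaving the jet of the unit section. -/
theorem jet_one (hη : Γ.IsMultiplicativeLift η) (g : N) :
    Γ.jet Γ.one (Γ.proj g) = η (Γ.one (Γ.proj g)) := by
  obtain ⟨σ, hσ, hσx, hσj⟩ := hη.exists_isSectionAt (Γ.one (Γ.proj g))
  rw [Γ.proj_one] at hσ hσx hσj
  have h11 : Γ.mul (Γ.one (Γ.proj g)) (Γ.one (Γ.proj g)) = Γ.one (Γ.proj g) := by
    have h := Γ.one_mul (Γ.one (Γ.proj g))
    rwa [Γ.proj_one] at h
  have hσσ : Γ.jet (fun y => Γ.mul (σ y) (σ y)) (Γ.proj g) = Γ.jet σ (Γ.proj g) := by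
    rw [hη.jet_mul hσ hσ (hσx.symm ▸ hσj) (hσx.symm ▸ hσj), hσx, h11, hσj]
  obtain ⟨B, hB⟩ := exists_mulDeriv (Γ.proj_inv (σ (Γ.proj g)))
  have h1 := hB hσ.inv (hσ.mul hσ) rfl (by rw [hσx, h11])
  have h2 := hB hσ.inv hσ rfl rfl
  rw [hσσ, ← h2] at h1
  rw [← hσj]
  have e1 : Γ.jet (fun y => Γ.mul (Γ.inv (σ y)) (Γ.mul (σ y) (σ y))) (Γ.proj g) =
      Γ.jet σ (Γ.proj g) :=
    mderiv_congr (Filter.Eventually.of_forall fun y => Γ.inv_mul_cancel_left rfl)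
  have e2 : Γ.jet (fun y => Γ.mul (Γ.inv (σ y)) (σ y)) (Γ.proj g) = Γ.jet Γ.one (Γ.proj g) := by
    refine mderiv_congr ?_
    filter_upwards [hσ.proj_eq] with y hy
    rw [Γ.inv_mul, hy]
  rw [← e1, ← e2, h1]

/-- For a horizontal section `τ` through `σ(x)⁻¹`, the product `σ τ` has the jet of the unit
section; cancelling `σ` identifies the jets of `τ` and `σ⁻¹`. -/
theorem jet_inv (hη : Γ.IsMultiplicativeLift η) {σ : M → N} {x : M} (hσ : Γ.IsSectionAt σ x)
    (hj : Γ.jet σ x = η (σ x)) : Γ.jet (fun y => Γ.inv (σ y)) x = η (Γ.inv (σ x)) := by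
  obtain ⟨τ, hτ, hτx, hτj⟩ := hη.exists_isSectionAt (Γ.inv (σ x))
  rw [Γ.proj_inv, hσ.proj_apply] at hτ hτx hτj
  have h1x : Γ.mul (σ x) (τ x) = Γ.one x := by rw [hτx, Γ.mul_inv, hσ.proj_apply]
  have hστ : Γ.jet (fun y => Γ.mul (σ y) (τ y)) x = Γ.jet Γ.one x := by
    have h := hη.jet_one (σ x)
    rw [hσ.proj_apply] at h
    rw [hη.jet_mul hσ hτ hj (hτx.symm ▸ hτj), h1x, h]
  have h0 := Γ.proj_one (σ x)
  rw [hσ.proj_apply] at h0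
  obtain ⟨B, hB⟩ := exists_mulDeriv (Γ := Γ) (a := Γ.inv (σ x)) (b := Γ.one x)
    (by rw [Γ.proj_inv, hσ.proj_apply, h0])
  have h1 := hB hσ.inv (hσ.mul hτ) rfl h1x
  have h2 := hB hσ.inv hσ.one rfl rfl
  rw [hστ, ← h2] at h1
  rw [← hτj]
  have e1 : Γ.jet (fun y => Γ.mul (Γ.inv (σ y)) (Γ.mul (σ y) (τ y))) x = Γ.jet τ x := by
    refine mderiv_congr ?_
    filter_upwards [hσ.proj_eq_proj hτ] with y hy
    exact Γ.inv_mul_cancel_left hy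
  have e2 : Γ.jet (fun y => Γ.mul (Γ.inv (σ y)) (Γ.one y)) x =
      Γ.jet (fun y => Γ.inv (σ y)) x := by
    refine mderiv_congr ?_
    filter_upwards [hσ.inv.proj_eq] with y hy
    have h := Γ.mul_one (Γ.inv (σ y))
    rwa [hy] at h
  rw [← e1, ← e2, h1]

end IsMultiplicativeLift

end SmoothGroupBundle

/-! ### Smooth maps into a disjoint union -/

section Components

variable {G : ℕ → Type v}

/-- The element of `G n` represented by an element of the disjoint union, if there is one. -/
def Arrows.component {n : ℕ} (default : G n) (a : Arrows G) : G n :=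
  open Classical in if h : a.1 = n then h ▸ a.2 else default

@[simp]
theorem Arrows.component_mk {n : ℕ} (default g : G n) :
    Arrows.component default ⟨n, g⟩ = g := by
  simp [Arrows.component]

theorem Arrows.mk_component {n : ℕ} (default : G n) {a : Arrows G} (h : a.1 = n) :
    (⟨n, Arrows.component default a⟩ : Arrows G) = a := by
  obtain ⟨m, g⟩ := a
  obtain rfl : m = n := h
  rw [Arrows.component_mk]

variable [∀ n, TopologicalSpace (G n)] [∀ n, ChartedSpace (Model n) (G n)]

section

variable {E : Type*} [NormedAddCommGroup E] [NormedSpace ℝ E] {H : Type*} [TopologicalSpace H]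
  {I : ModelWithCorners ℝ E H} {N : Type w} [TopologicalSpace N] [ChartedSpace H N]

theorem SmoothFrom.exists_tangent_eq {S : Set N} {f : ∀ x : N, x ∈ S → Arrows G}
    (hf : SmoothFrom I S f) (ξ : TangentBundle I N) (hξ : ξ.proj ∈ S) :
    ∃ (n : ℕ) (F : N → G n), IsLocalExtension I S f ξ.proj n F ∧
      hf.tangent ξ hξ = ⟨n, tangentMap I (𝓡 n) F ξ⟩ :=
  ⟨_, _, (hf ξ.proj hξ).choose_spec.choose_spec, rfl⟩

variable (I) in
/-- Smoothness at a point of a map to a disjoint union of manifolds. -/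
def ArrowSmoothAt (a : N → Arrows G) (x : N) : Prop :=
  ∃ (n : ℕ) (F : N → G n), ContMDiffAt I (𝓡 n) ∞ F x ∧ ∀ᶠ y in 𝓝 x, a y = ⟨n, F y⟩

theorem ArrowSmoothAt.of_contMDiffAt {n : ℕ} {F : N → G n} {x : N}
    (h : ContMDiffAt I (𝓡 n) ∞ F x) : ArrowSmoothAt I (fun y => (⟨n, F y⟩ : Arrows G)) x :=
  ⟨n, F, h, Filter.Eventually.of_forall fun _ => rfl⟩

theorem ArrowSmoothAt.exists_eq {a : N → Arrows G} {x : N} (h : ArrowSmoothAt I a x) {n : ℕ}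
    (hn : (a x).1 = n) :
    ∃ F : N → G n, ContMDiffAt I (𝓡 n) ∞ F x ∧ ∀ᶠ y in 𝓝 x, a y = ⟨n, F y⟩ := by
  obtain ⟨m, F, hF, hev⟩ := h
  obtain rfl : m = n := by rw [← hn, hev.self_of_nhds]
  exact ⟨F, hF, hev⟩

theorem ArrowSmoothAt.contMDiffAt_component {a : N → Arrows G} {x : N}
    (h : ArrowSmoothAt I a x) {n : ℕ} (hn : (a x).1 = n) (default : N → G n) :
    ContMDiffAt I (𝓡 n) ∞ (fun y => (a y).component (default y)) x := by
  obtain ⟨F, hF, hev⟩ := h.exists_eq hn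
  refine hF.congr_of_eventuallyEq ?_
  filter_upwards [hev] with y hy
  rw [hy, Arrows.component_mk]

end

end Components

/-! ### Reduction of a groupoid with `s = t` to group bundles of constant dimension. -/

namespace DiffGroupoid

variable {d : ℕ} {M : Type u} [TopologicalSpace M] [ChartedSpace (Model d) M]
  {G : ℕ → Type v} [∀ n, TopologicalSpace (G n)] [∀ n, ChartedSpace (Model n) (G n)]
  (Γ : DiffGroupoid d M G)

/-- The composition, extended arbitrarily to all pairs of arrows. -/
def totalMul (a b : Arrows G) : Arrows G :=
  open Classical in if h : Γ.src a = Γ.tgt b then Γ.mul a b h else b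

variable {Γ}

theorem totalMul_eq {a b : Arrows G} (h : Γ.src a = Γ.tgt b) : Γ.totalMul a b = Γ.mul a b h :=
  dif_pos h

theorem src_totalMul {a b : Arrows G} (h : Γ.src a = Γ.tgt b) :
    Γ.src (Γ.totalMul a b) = Γ.src b := by
  rw [totalMul_eq h, Γ.src_mul]

theorem tgt_totalMul {a b : Arrows G} (h : Γ.src a = Γ.tgt b) :
    Γ.tgt (Γ.totalMul a b) = Γ.tgt a := by
  rw [totalMul_eq h, Γ.tgt_mul]

theorem totalMul_assoc {a b c : Arrows G} (h : Γ.src a = Γ.tgt b) (h' : Γ.src b = Γ.tgt c) :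
    Γ.totalMul (Γ.totalMul a b) c = Γ.totalMul a (Γ.totalMul b c) := by
  rw [totalMul_eq (a := a) (b := Γ.totalMul b c) (h.trans (tgt_totalMul h').symm),
    totalMul_eq (a := Γ.totalMul a b) (b := c) ((src_totalMul h).trans h')]
  simp only [totalMul_eq h, totalMul_eq h']
  exact Γ.mul_assoc a b c h h'

theorem one_totalMul (a : Arrows G) : Γ.totalMul (Γ.one (Γ.tgt a)) a = a := by
  rw [totalMul_eq (Γ.src_one _), Γ.one_mul]

theorem totalMul_one (a : Arrows G) : Γ.totalMul a (Γ.one (Γ.src a)) = a := by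
  rw [totalMul_eq (Γ.tgt_one _).symm, Γ.mul_one]

theorem inv_totalMul (a : Arrows G) : Γ.totalMul (Γ.inv a) a = Γ.one (Γ.src a) := by
  rw [totalMul_eq (Γ.src_inv _), Γ.inv_mul]

theorem totalMul_inv (a : Arrows G) : Γ.totalMul a (Γ.inv a) = Γ.one (Γ.tgt a) := by
  rw [totalMul_eq (Γ.tgt_inv _).symm, Γ.mul_inv]

section

variable {E : Type*} [NormedAddCommGroup E] [NormedSpace ℝ E] {H : Type*} [TopologicalSpace H]
  {I : ModelWithCorners ℝ E H} {N : Type w} [TopologicalSpace N] [ChartedSpace H N]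

theorem arrowSmoothAt_one (x : M) : ArrowSmoothAt (𝓡 d) Γ.one x := by
  obtain ⟨n, F, hF, hev⟩ := Γ.smooth_one x (Set.mem_univ x)
  exact ⟨n, F, hF, hev.mono fun y hy => hy (Set.mem_univ y)⟩

theorem arrowSmoothAt_inv {a : N → Arrows G} {x : N} (ha : ArrowSmoothAt I a x) :
    ArrowSmoothAt I (fun y => Γ.inv (a y)) x := by
  obtain ⟨m, A, hA, hAev⟩ := ha
  obtain ⟨n, F, hF, hev⟩ := Γ.smooth_inv m (A x) (Set.mem_univ _)
  refine ⟨n, fun y => F (A y), ContMDiffAt.comp x (g := F) hF hA, ?_⟩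
  filter_upwards [hAev, hA.continuousAt.eventually hev] with y h1 h2
  rw [h1, h2 (Set.mem_univ _)]

theorem arrowSmoothAt_totalMul {a b : N → Arrows G} {x : N} (ha : ArrowSmoothAt I a x)
    (hb : ArrowSmoothAt I b x) (h : ∀ᶠ y in 𝓝 x, Γ.src (a y) = Γ.tgt (b y)) :
    ArrowSmoothAt I (fun y => Γ.totalMul (a y) (b y)) x := by
  obtain ⟨m, A, hA, hAev⟩ := ha
  obtain ⟨m', B, hB, hBev⟩ := hb
  have h0 := h.self_of_nhds
  rw [hAev.self_of_nhds, hBev.self_of_nhds] at h0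
  obtain ⟨n, F, hF, hev⟩ := Γ.smooth_mul m m' (A x, B x) h0
  refine ⟨n, fun y => F (A y, B y),
    ContMDiffAt.comp x (g := F) (f := fun y => (A y, B y)) hF (hA.prodMk hB), ?_⟩
  have hc : ContinuousAt (fun y => (A y, B y)) x := hA.continuousAt.prodMk hB.continuousAt
  filter_upwards [hAev, hBev, h, hc.eventually hev] with y h1 h2 h3 h4
  rw [h1, h2] at h3
  rw [h1, h2, totalMul_eq h3]
  exact h4 h3

end

namespace IsGroupBundle

variable [IsManifold (𝓡 d) ∞ M] [∀ n, IsManifold (𝓡 n) ∞ (G n)]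

/-- For a local section `σ` through the arrow `g`, the map `k ↦ σ(s k) k` carries a neighbourhood of
the unit to one of `g`, with inverse `k ↦ σ(s k)⁻¹ k`. The dimensions at the two points therefore
agree. -/
theorem fst_eq_fst_one (hb : Γ.IsGroupBundle) (a : Arrows G) :
    a.1 = (Γ.one (Γ.src a)).1 := by
  obtain ⟨m, g⟩ := a
  rcases he : Γ.one (Γ.src ⟨m, g⟩) with ⟨n, e⟩
  have hex : Γ.src ⟨n, e⟩ = Γ.src ⟨m, g⟩ := by rw [← he, Γ.src_one]
  obtain ⟨Φ, hΦ⟩ := exists_sliceChart ((Γ.submersion_src m).isSubmersionAt g)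
  let σ : M → G m := fun x => Φ.chart.symm (x, (Φ.chart g).2)
  have hσ : ContMDiffAt (𝓡 d) (𝓡 m) ∞ σ (Γ.src ⟨m, g⟩) :=
    ContMDiffAt.comp (Γ.src ⟨m, g⟩) (g := Φ.chart.symm) (f := fun x => (x, (Φ.chart g).2))
      (Φ.contMDiffAt_symm (Φ.mem_target hΦ)) (contMDiffAt_id.prodMk contMDiffAt_const)
  have hσg : σ (Γ.src ⟨m, g⟩) = g := Φ.symm_snd hΦ
  have hσs : ∀ᶠ x in 𝓝 (Γ.src ⟨m, g⟩), Γ.src ⟨m, σ x⟩ = x := by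
    filter_upwards [(Continuous.prodMk_left (Φ.chart g).2).continuousAt.eventually
      (Φ.chart.open_target.mem_nhds (Φ.mem_target hΦ))] with x hx
    exact Φ.proj_symm hx
  have hsrc : ∀ (l : ℕ) (k : G l), Γ.src ⟨l, k⟩ = Γ.src ⟨m, g⟩ →
      ContMDiffAt (𝓡 l) (𝓡 m) ∞ (fun k => σ (Γ.src ⟨l, k⟩)) k ∧
        ∀ᶠ k in 𝓝 k, Γ.src ⟨m, σ (Γ.src ⟨l, k⟩)⟩ = Γ.src ⟨l, k⟩ := by
    intro l k hk
    have hp : ContMDiffAt (𝓡 l) (𝓡 d) ∞ (fun k => Γ.src ⟨l, k⟩) k :=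
      (Γ.submersion_src l).contMDiff k
    rw [← hk] at hσ hσs
    exact ⟨ContMDiffAt.comp k (g := σ) hσ hp, hp.continuousAt.eventually hσs⟩
  obtain ⟨hn, hn'⟩ := hsrc n e hex
  obtain ⟨hm, hm'⟩ := hsrc m g rfl
  have hL := arrowSmoothAt_totalMul (Γ := Γ) (.of_contMDiffAt hn)
    (.of_contMDiffAt (F := fun k => k) contMDiffAt_id) (hn'.mono fun k hk => hk.trans (hb _))
  have hL' := arrowSmoothAt_totalMul (Γ := Γ) (arrowSmoothAt_inv (.of_contMDiffAt hm))
    (.of_contMDiffAt (F := fun k => k) contMDiffAt_id) (hm'.mono fun k hk => by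
      rw [Γ.src_inv, ← hb, hk, hb])
  have hLe : Γ.totalMul ⟨m, σ (Γ.src ⟨n, e⟩)⟩ ⟨n, e⟩ = ⟨m, g⟩ := by
    rw [hex, hσg, ← he, totalMul_one]
  have hLg : Γ.totalMul (Γ.inv ⟨m, σ (Γ.src ⟨m, g⟩)⟩) ⟨m, g⟩ = ⟨n, e⟩ := by
    rw [hσg, inv_totalMul, he]
  obtain ⟨F, hF, hFev⟩ := hL.exists_eq (n := m) (by rw [hLe])
  obtain ⟨F', hF', hFev'⟩ := hL'.exists_eq (n := n) (by rw [hLg])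
  have hFe : F e = g := sigma_mk_injective (hFev.self_of_nhds.symm.trans hLe)
  have hFg : F' g = e := sigma_mk_injective (hFev'.self_of_nhds.symm.trans hLg)
  refine (dimension_eq_of_local_inverse hF hF' hFe hFg ?_ ?_).symm
  · have h1 : ∀ᶠ k in 𝓝 e, Γ.totalMul (Γ.inv ⟨m, σ (Γ.src ⟨m, F k⟩)⟩) ⟨m, F k⟩ = ⟨n, F' (F k)⟩ :=
      hF.continuousAt.eventually (hFe ▸ hFev')
    filter_upwards [h1, hFev, hn'] with k h2 h3 h4
    refine sigma_mk_injective (i := n) (h2.symm.trans ?_)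
    have h5 : Γ.src ⟨m, σ (Γ.src ⟨n, k⟩)⟩ = Γ.tgt ⟨n, k⟩ := h4.trans (hb _)
    rw [← h3, src_totalMul h5, ← totalMul_assoc (Γ.src_inv _) h5, inv_totalMul, h5, one_totalMul]
  · have h1 : ∀ᶠ k in 𝓝 g, Γ.totalMul ⟨m, σ (Γ.src ⟨n, F' k⟩)⟩ ⟨n, F' k⟩ = ⟨m, F (F' k)⟩ :=
      hF'.continuousAt.eventually (hFg ▸ hFev)
    filter_upwards [h1, hFev', hm'] with k h2 h3 h4
    refine sigma_mk_injective (i := m) (h2.symm.trans ?_)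
    have h5 : Γ.tgt ⟨m, σ (Γ.src ⟨m, k⟩)⟩ = Γ.tgt ⟨m, k⟩ := (hb _).symm.trans (h4.trans (hb _))
    have h6 := (Γ.src_inv ⟨m, σ (Γ.src ⟨m, k⟩)⟩).trans h5
    rw [← h3, src_totalMul h6, ← totalMul_assoc (Γ.tgt_inv _).symm h6, totalMul_inv, h5,
      one_totalMul]

theorem fst_eq_of_src_eq (hb : Γ.IsGroupBundle) {a b : Arrows G} (h : Γ.src a = Γ.src b) :
    a.1 = b.1 := by
  rw [hb.fst_eq_fst_one a, hb.fst_eq_fst_one b, h]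

theorem fst_inv (hb : Γ.IsGroupBundle) (a : Arrows G) : (Γ.inv a).1 = a.1 :=
  hb.fst_eq_of_src_eq (by rw [Γ.src_inv, hb])

theorem fst_totalMul (hb : Γ.IsGroupBundle) {a b : Arrows G} (h : Γ.src a = Γ.src b) :
    (Γ.totalMul a b).1 = b.1 :=
  hb.fst_eq_of_src_eq (src_totalMul (h.trans (hb b)))

/-- The arrows of a given dimension form a bundle of groups. -/
def smoothGroupBundle (hb : Γ.IsGroupBundle) (hp : Γ.IsProper) (n : ℕ) (hne : Nonempty (G n)) :
    SmoothGroupBundle d n M (G n) where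
  proj g := Γ.src ⟨n, g⟩
  -- The default values are immaterial: products within a fibre, inverses, and units over the image
  -- of `G n` stay in dimension `n`. Only units over other points use `hne.some`.
  mul a b := (Γ.totalMul ⟨n, a⟩ ⟨n, b⟩).component b
  one x := (Γ.one x).component hne.some
  inv a := (Γ.inv ⟨n, a⟩).component a
  proj_mul {a b} h := by
    rw [Arrows.mk_component _ (hb.fst_totalMul h), src_totalMul (h.trans (hb _))]
  proj_one g := by
    rw [Arrows.mk_component _ (hb.fst_eq_fst_one ⟨n, g⟩).symm, Γ.src_one]
  proj_inv g := by
    rw [Arrows.mk_component _ (hb.fst_inv ⟨n, g⟩), Γ.src_inv, hb]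
  mul_assoc {a b c} h h' := by
    rw [Arrows.mk_component _ (hb.fst_totalMul h), Arrows.mk_component _ (hb.fst_totalMul h'),
      totalMul_assoc (h.trans (hb _)) (h'.trans (hb _))]
    refine sigma_mk_injective (i := n) ?_
    have h1 : Γ.src ⟨n, a⟩ = Γ.src (Γ.totalMul ⟨n, b⟩ ⟨n, c⟩) :=
      (h.trans h').trans (src_totalMul (h'.trans (hb _))).symm
    have h2 := (hb.fst_totalMul h1).trans (hb.fst_totalMul h')
    rw [Arrows.mk_component _ h2, Arrows.mk_component _ h2]
  one_mul g := by
    rw [Arrows.mk_component _ (hb.fst_eq_fst_one ⟨n, g⟩).symm, hb, one_totalMul,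
      Arrows.component_mk]
  mul_one g := by
    rw [Arrows.mk_component _ (hb.fst_eq_fst_one ⟨n, g⟩).symm, totalMul_one]
    exact Arrows.component_mk _ _
  inv_mul g := by
    rw [Arrows.mk_component _ (hb.fst_inv ⟨n, g⟩), inv_totalMul]
    refine sigma_mk_injective (i := n) ?_
    have h := (hb.fst_eq_fst_one ⟨n, g⟩).symm
    rw [Arrows.mk_component _ h, Arrows.mk_component _ h]
  mul_inv g := by
    rw [Arrows.mk_component _ (hb.fst_inv ⟨n, g⟩), totalMul_inv, ← hb]
    refine sigma_mk_injective (i := n) ?_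
    have h := (hb.fst_eq_fst_one ⟨n, g⟩).symm
    rw [Arrows.mk_component _ h, Arrows.mk_component _ h]
  submersion := Γ.submersion_src n
  smooth_one g := (arrowSmoothAt_one _).contMDiffAt_component
    (hb.fst_eq_fst_one ⟨n, g⟩).symm (fun _ => hne.some)
  smooth_inv a := (arrowSmoothAt_inv (.of_contMDiffAt (F := fun a => a)
    contMDiffAt_id)).contMDiffAt_component (hb.fst_inv ⟨n, a⟩) (fun a => a)
  smooth_mul {a b} h := by
    have hab : Γ.src ⟨n, a⟩ = Γ.tgt ⟨n, b⟩ := h.trans (hb _)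
    obtain ⟨l, F, hF, hev⟩ := Γ.smooth_mul n n (a, b) hab
    have h0 : Γ.mul ⟨n, a⟩ ⟨n, b⟩ hab = ⟨l, F (a, b)⟩ := hev.self_of_nhds hab
    obtain rfl : l = n := by
      have h1 := hb.fst_totalMul h
      rw [totalMul_eq hab, h0] at h1
      exact h1
    refine ⟨F, hF, hev.mono fun p hp hpp => ?_⟩
    have hpp' : Γ.src ⟨l, p.1⟩ = Γ.tgt ⟨l, p.2⟩ := Eq.trans hpp (hb _)
    have h1 : Γ.mul ⟨l, p.1⟩ ⟨l, p.2⟩ hpp' = ⟨l, F p⟩ := hp hpp'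
    rw [totalMul_eq hpp', h1, Arrows.component_mk]
  isCompact_preimage K hK := by
    -- As `s = t`, the preimage of `K` is the trace on `G n` of the anchor preimage of `K × K`, and
    -- `G n` is closed in the disjoint union.
    have h1 := Topology.IsClosedEmbedding.sigmaMk (σ := G) (i := n) |>.isCompact_preimage
      (hp.2.2 (K ×ˢ K) (hK.prod hK))
    refine (congrArg IsCompact ?_).mp h1
    ext g
    simp only [Set.mem_preimage, Set.mem_prod, ← hb ⟨n, g⟩, and_self]

end IsGroupBundle

end DiffGroupoid

/-! ### Transfer to connections and to the tangent groupoid. -/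

namespace DiffGroupoid

variable {d : ℕ} {M : Type u} [TopologicalSpace M] [ChartedSpace (Model d) M]
  [IsManifold (𝓡 d) ∞ M] {G : ℕ → Type v} [∀ n, TopologicalSpace (G n)]
  [∀ n, ChartedSpace (Model n) (G n)] [∀ n, IsManifold (𝓡 n) ∞ (G n)] {Γ : DiffGroupoid d M G}

theorem Connection.mem_horizontal_of_eq (η : Γ.Connection) {n : ℕ} {g g' : G n}
    {w : Model n} {v : Model d} (hg : g = g') (h : w = (η.lift n g' : Model d →L[ℝ] Model n) v) :
    (⟨n, ⟨g, w⟩⟩ : TArrows G) ∈ η.horizontal := by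
  subst hg h
  exact ⟨n, g, v, rfl⟩

/-- The connection on a bundle of groups given by lifts on its parts of constant dimension. -/
def IsGroupBundle.connection (hb : Γ.IsGroupBundle) (hp : Γ.IsProper)
    {η : ∀ n, G n → Model d →L[ℝ] Model n}
    (hη : ∀ n (h : Nonempty (G n)), (hb.smoothGroupBundle hp n h).IsMultiplicativeLift (η n)) :
    Γ.Connection where
  lift n g := η n g
  smooth_lift n g₀ := (hη n ⟨g₀⟩).smooth g₀
  src_lift n g v := congrArg (fun L : Model d →L[ℝ] Model d => L v) ((hη n ⟨g⟩).mderiv_proj_comp g)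

/-- The tangent structure maps are computed from chosen local extensions. These agree near the point
with the bundle operations, for products along composable pairs, so the identities between jets of
sections carry over. -/
theorem IsGroupBundle.isMultiplicative_connection (hb : Γ.IsGroupBundle) (hp : Γ.IsProper)
    {η : ∀ n, G n → Model d →L[ℝ] Model n}
    (hη : ∀ n (h : Nonempty (G n)), (hb.smoothGroupBundle hp n h).IsMultiplicativeLift (η n)) :
    (hb.connection hp hη).IsMultiplicative where
  tone_mem := by
    rintro ⟨x, v⟩
    obtain ⟨n, F, ⟨-, hev⟩, ht⟩ := Γ.smooth_one.exists_tangent_eq ⟨x, v⟩ (Set.mem_univ _)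
    have hx : Γ.one x = ⟨n, F x⟩ := hev.self_of_nhds (Set.mem_univ _)
    have hsx : Γ.src ⟨n, F x⟩ = x := by rw [← hx, Γ.src_one]
    have hne : Nonempty (G n) := ⟨F x⟩
    have h1 := (hη n hne).jet_one (F x)
    have h2 : (hb.smoothGroupBundle hp n hne).one =ᶠ[𝓝 x] F := by
      filter_upwards [hev] with y hy
      change (Γ.one y).component _ = _
      rw [hy (Set.mem_univ _), Arrows.component_mk]
    rw [show (hb.smoothGroupBundle hp n hne).proj (F x) = x from hsx, SmoothGroupBundle.jet,
      mderiv_congr h2, h2.self_of_nhds] at h1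
    rw [tone, ht]
    exact (hb.connection hp hη).mem_horizontal_of_eq (v := v) rfl
      (congrArg (fun L : Model d →L[ℝ] Model n => L v) h1)
  tinv_mem := by
    rintro _ ⟨n, g, v, rfl⟩
    obtain ⟨l, F, ⟨hF, hev⟩, ht⟩ :=
      (Γ.smooth_inv n).exists_tangent_eq ⟨g, (hb.connection hp hη).lift n g v⟩ (Set.mem_univ _)
    have hg : Γ.inv ⟨n, g⟩ = ⟨l, F g⟩ := hev.self_of_nhds (Set.mem_univ _)
    obtain rfl : l = n := by
      have h := hb.fst_inv ⟨n, g⟩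
      rwa [hg] at h
    have hne : Nonempty (G l) := ⟨g⟩
    obtain ⟨σ, hσ, hσx, hσj⟩ := (hη l hne).exists_isSectionAt g
    have h1 := (hη l hne).jet_inv hσ (hσx.symm ▸ hσj)
    have h2 : (hb.smoothGroupBundle hp l hne).inv =ᶠ[𝓝 g] F := by
      filter_upwards [hev] with a ha
      change (Γ.inv ⟨l, a⟩).component _ = _
      rw [ha (Set.mem_univ _), Arrows.component_mk]
    rw [SmoothGroupBundle.jet_inv_eq hσ hσx, mderiv_congr h2, hσj, hσx, h2.self_of_nhds] at h1
    rw [tinv, ht]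
    exact (hb.connection hp hη).mem_horizontal_of_eq (v := v) rfl
      (congrArg (fun L : Model d →L[ℝ] Model l => L v) h1)
  tmul_mem := by
    rintro _ ⟨n, g', v', rfl⟩ _ ⟨n', g, v, rfl⟩ h
    have hsrc : Γ.src ⟨n, g'⟩ = Γ.tgt ⟨n', g⟩ := congrArg Bundle.TotalSpace.proj h
    have hs := hsrc.trans (hb _).symm
    obtain rfl : n = n' := hb.fst_eq_of_src_eq hs
    have hne : Nonempty (G n) := ⟨g⟩
    have hB := hη n hne
    -- Because `s = t`, composability forces both horizontal vectors to lift the same base vector;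
    -- the pair is then the image of that vector under the jets of `σ` and `τ`.
    have hv : (v' : Model d) = v := by
      have h1 : Γ.tsrc ⟨n, ⟨g', (hb.connection hp hη).lift n g' v'⟩⟩ = ⟨Γ.src ⟨n, g'⟩, v'⟩ :=
        congrArg (Bundle.TotalSpace.mk (Γ.src ⟨n, g'⟩)) ((hb.connection hp hη).src_lift n g' v')
      have h2 : Γ.ttgt ⟨n, ⟨g, (hb.connection hp hη).lift n g v⟩⟩ = ⟨Γ.src ⟨n, g⟩, v⟩ := by
        have h3 : (fun g => Γ.tgt ⟨n, g⟩) = fun g => Γ.src ⟨n, g⟩ := funext fun g => (hb _).symm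
        rw [ttgt]
        dsimp only
        rw [h3]
        exact congrArg (Bundle.TotalSpace.mk (Γ.src ⟨n, g⟩))
          ((hb.connection hp hη).src_lift n g v)
      exact congrArg (fun ξ : TangentBundle (𝓡 d) M => (ξ.2 : Model d))
        (h1.symm.trans (h.trans h2))
    obtain ⟨l, F, ⟨hF, hev⟩, ht⟩ := (Γ.smooth_mul n n).exists_tangent_eq
      ((equivTangentBundleProd (𝓡 n) (G n) (𝓡 n) (G n)).symm
        (⟨g', (hb.connection hp hη).lift n g' v'⟩, ⟨g, (hb.connection hp hη).lift n g v⟩)) hsrc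
    have hF0 : Γ.mul ⟨n, g'⟩ ⟨n, g⟩ hsrc = ⟨l, F (g', g)⟩ := hev.self_of_nhds hsrc
    obtain rfl : l = n := by
      have h1 := hb.fst_totalMul hs
      rw [totalMul_eq hsrc, hF0] at h1
      exact h1
    have hFm : ∀ᶠ p in 𝓝 (g', g), Γ.src ⟨l, p.1⟩ = Γ.src ⟨l, p.2⟩ →
        F p = (hb.smoothGroupBundle hp l hne).mul p.1 p.2 := by
      refine hev.mono fun p hpe hpp => ?_
      have hpp' : Γ.src ⟨l, p.1⟩ = Γ.tgt ⟨l, p.2⟩ := Eq.trans hpp (hb _)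
      have h1 : Γ.mul ⟨l, p.1⟩ ⟨l, p.2⟩ hpp' = ⟨l, F p⟩ := hpe hpp'
      change _ = (Γ.totalMul ⟨l, p.1⟩ ⟨l, p.2⟩).component p.2
      rw [totalMul_eq hpp', h1, Arrows.component_mk]
    obtain ⟨σ, hσ, hσx, hσj⟩ := hB.exists_isSectionAt g'
    obtain ⟨τ, hτ, hτx, hτj⟩ := hB.exists_isSectionAt g
    rw [show (hb.smoothGroupBundle hp l hne).proj g' = Γ.src ⟨l, g⟩ from hs] at hσ hσx hσj
    have h1 := hB.jet_mul hσ hτ (hσx.symm ▸ hσj) (hτx.symm ▸ hτj)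
    rw [SmoothGroupBundle.jet_mul_eq hF hFm hσ hτ hσx hτx] at h1
    have h2 : F (g', g) =
        (hb.smoothGroupBundle hp l hne).mul (σ (Γ.src ⟨l, g⟩)) (τ (Γ.src ⟨l, g⟩)) := by
      rw [hFm.self_of_nhds hs, hσx]
      exact congrArg _ hτx.symm
    rw [hσj, show (hb.smoothGroupBundle hp l hne).jet τ (Γ.src ⟨l, g⟩) = η l g from hτj] at h1
    rw [tmul, ht]
    refine (hb.connection hp hη).mem_horizontal_of_eq (v := v) h2 ?_
    refine Eq.trans ?_ (congrArg (fun L : Model d →L[ℝ] Model l => L v) h1)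
    rw [hv]
    rfl

theorem IsGroupBundle.exists_isMultiplicative (hb : Γ.IsGroupBundle) (hLie : Γ.IsLie)
    (hp : Γ.IsProper) : ∃ η : Γ.Connection, η.IsMultiplicative := by
  have : T2Space M := hp.1
  have : T2Space (Arrows G) := hp.2.1
  have : SecondCountableTopology (Arrows G) := hLie.2.2
  have key : ∀ n, ∃ η : G n → Model d →L[ℝ] Model n, ∀ h : Nonempty (G n),
      (hb.smoothGroupBundle hp n h).IsMultiplicativeLift η := by
    intro n
    by_cases h : Nonempty (G n)
    · have : T2Space (G n) := (Topology.IsEmbedding.sigmaMk (σ := G) (i := n)).t2Space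
      have : SecondCountableTopology (G n) :=
        (Topology.IsEmbedding.sigmaMk (σ := G) (i := n)).secondCountableTopology
      have : LocallyCompactSpace (G n) := ChartedSpace.locallyCompactSpace (Model n) (G n)
      obtain ⟨η, hη⟩ := (hb.smoothGroupBundle hp n h).exists_isMultiplicativeLift
      exact ⟨η, fun _ => hη⟩
    · exact ⟨fun _ => 0, fun h' => absurd h' h⟩
  choose η hη using key
  exact ⟨_, hb.isMultiplicative_connection hp hη⟩

end DiffGroupoid

end

theorem corollary3p8 {d : ℕ} {M : Type u} [TopologicalSpace M] [ChartedSpace (Model d) M]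
    [IsManifold (𝓡 d) ∞ M]
    {G : ℕ → Type v} [∀ n, TopologicalSpace (G n)] [∀ n, ChartedSpace (Model n) (G n)]
    [∀ n, IsManifold (𝓡 n) ∞ (G n)]
    (Γ : DiffGroupoid d M G) (hLie : Γ.IsLie) (hproper : Γ.IsProper)
    (hbundle : Γ.IsGroupBundle) :
    ∃ η : Γ.Connection, η.IsMultiplicative :=
  hbundle.exists_isMultiplicative hLie hproper
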